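/- Let $n\ge 2$, let $M$ and $N$ be smooth (Hausdorff, second countable) manifolds without boundary, of dimensions $n$ and $n-2$, with volume forms (nowhere vanishing smooth forms of top degree) $\mu$ on $M$ and $\Omega$ on $N$. Let $f\colon M\to N$ be a smooth map and let $k\in C^\infty(M)$ vanish nowhere. Then $$\{g,h\}\,\mu = k\,dg\wedge dh\wedge f^*\Omega,\qquad g,h\in C^\infty(M),$$ defines a unique operation $\{\cdot,\cdot\}$ on $C^\infty(M)$, and it is a Poisson bracket, i.e. a Lie bracket that is a derivation in each factor. The symplectic leaf through $q\in M$ is the set of points that can be joined with $q$ by a piecewise smooth curve each of whose pieces is a trajectory of a locally defined Hamiltonian vector field $X_h=\{\cdot,h\}$. Let $C\subset M$ be the set of critical points of $f$ (the points where $df$ is not surjective), call the points of $f(C)$ the singular values of $f$, and those of $N\setminus f(C)$ its regular values. Every symplectic leaf is an embedded submanifold of $M$, tangent to the characteristic distribution $\{X_h(q) : h\in C^\infty(M)\}$, of dimension $2$ or $0$. The leaves are precisely the following sets: (i) the connected components of $f^{-1}(s)$, for $s\in N$ a regular value of $f$; they are $2$-dimensional; (ii) the connected components of $f^{-1}(s)\setminus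 C$, for $s\in N$ a singular value of $f$; they are $2$-dimensional; (iii) the single points of $C$; they are $0$-dimensional. -/

import Mathlib

open scoped Manifold ContDiff

noncomputable section

/-! ### Differential forms -/

/-- The wedge product `α ∧ η` of a covector with an alternating `p`-form, normalised so that
`(α ∧ η)(v₀, …, v_p) = ∑ i, (-1)^i α(v_i) η(v₀, …, v̂_i, …, v_p)`. -/
def covectorWedge {V : Type*} [AddCommGroup V] [Module ℝ V] {p : ℕ}
    (α : V →ₗ[ℝ] ℝ) (η : V [⋀^Fin p]→ₗ[ℝ] ℝ) : V [⋀^Fin (p + 1)]→ₗ[ℝ] ℝ :=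
  AlternatingMap.alternatizeUncurryFin (α.smulRight η)

/-- A volume form on a smooth `n`-manifold: a nowhere vanishing `n`-form that is smooth, that is,
its coefficients with respect to the coordinate vector fields of every chart are smooth. -/
structure VolumeForm (n : ℕ) (M : Type*) [TopologicalSpace M]
    [ChartedSpace (EuclideanSpace ℝ (Fin n)) M] where
  /-- The value of the form at a point. -/
  toForm : ∀ x : M, (TangentSpace (𝓡 n) x) [⋀^Fin n]→ₗ[ℝ] ℝ
  smooth : ∀ (x₀ : M) (v : Fin n → EuclideanSpace ℝ (Fin n)),
    ContDiffOn ℝ ∞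
      (fun y => toForm ((extChartAt (𝓡 n) x₀).symm y)
        (fun i => mfderiv 𝓘(ℝ, EuclideanSpace ℝ (Fin n)) (𝓡 n)
          (extChartAt (𝓡 n) x₀).symm y (v i)))
      (extChartAt (𝓡 n) x₀).target
  ne_zero : ∀ x : M, toForm x ≠ 0

/-! ### Poisson structures and their symplectic leaves -/

/-- A Poisson bracket on a smooth manifold `M`: a Lie bracket on `C^∞(M)` which is a derivation in
each factor. -/
structure PoissonBracket (n : ℕ) (M : Type*) [TopologicalSpace M]
    [ChartedSpace (EuclideanSpace ℝ (Fin n)) M] where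
  /-- The bracket `{g, h}`, as a bilinear map. -/
  bracket : C^∞⟮𝓡 n, M; ℝ⟯ →ₗ[ℝ] C^∞⟮𝓡 n, M; ℝ⟯ →ₗ[ℝ] C^∞⟮𝓡 n, M; ℝ⟯
  bracket_self : ∀ g, bracket g g = 0
  jacobi : ∀ g h l,
    bracket g (bracket h l) + bracket h (bracket l g) + bracket l (bracket g h) = 0
  leibniz_left : ∀ g h l, bracket (g * h) l = g * bracket h l + h * bracket g l
  leibniz_right : ∀ g h l, bracket l (g * h) = g * bracket l h + h * bracket l g

namespace PoissonBracket

variable {n : ℕ} {M : Type*} [TopologicalSpace M] [ChartedSpace (EuclideanSpace ℝ (Fin n)) M]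

/-- `P.Sharp q α v` says that `v = 𝓑_q(α)`, where `𝓑 : T*M → TM`, `𝓑(α) = π(·, α)`, is the bundle
map of the Poisson bivector `π`, given by `π(dg, dh) = {g, h}`. -/
def Sharp (P : PoissonBracket n M) (q : M) (α : TangentSpace (𝓡 n) q →L[ℝ] ℝ)
    (v : TangentSpace (𝓡 n) q) : Prop :=
  ∃ h : C^∞⟮𝓡 n, M; ℝ⟯, mvfderiv (𝓡 n) h q = α ∧
    ∀ g : C^∞⟮𝓡 n, M; ℝ⟯, mvfderiv (𝓡 n) g q v = P.bracket g h q

/-- The characteristic distribution `D_q = 𝓑_q(T*_q M)`; equivalently, the values at `q` of the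
Hamiltonian vector fields `X_h = {·, h}`. -/
def charDist (P : PoissonBracket n M) (q : M) : Submodule ℝ (TangentSpace (𝓡 n) q) where
  carrier := {v | ∃ h : C^∞⟮𝓡 n, M; ℝ⟯, P.Sharp q (mvfderiv (𝓡 n) h q) v}
  zero_mem' := ⟨0, 0, rfl, fun g => by simp⟩
  add_mem' := by
    rintro v w ⟨-, h, -, hv⟩ ⟨-, l, -, hw⟩
    exact ⟨h + l, h + l, rfl, fun g => by simp [hv g, hw g]⟩
  smul_mem' := by
    rintro c v ⟨-, h, -, hv⟩
    exact ⟨c • h, c • h, rfl, fun g => by simp [hv g]⟩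

/-- `p` and `q` are the endpoints of a (compact) piece of a trajectory of a locally defined
Hamiltonian vector field `X_h = 𝓑(dh)`, with `h` smooth on an open set `U`. -/
def HamiltonianStep (P : PoissonBracket n M) (p q : M) : Prop :=
  ∃ (U : Set M) (h : M → ℝ) (X : ∀ x : M, TangentSpace (𝓡 n) x) (γ : ℝ → M) (a b : ℝ),
    IsOpen U ∧ ContMDiffOn (𝓡 n) 𝓘(ℝ, ℝ) ∞ h U ∧
    (∀ x ∈ U, P.Sharp x (mvfderiv (𝓡 n) h x) (X x)) ∧
    a ≤ b ∧ γ a = p ∧ γ b = q ∧ (∀ t ∈ Set.Icc a b, γ t ∈ U) ∧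
    IsMIntegralCurveOn γ X (Set.Icc a b)

/-- The symplectic leaf through `q`: all points that can be joined with `q` by a piecewise smooth
curve each of whose pieces is a trajectory of a locally defined Hamiltonian vector field. (Steps can
be reversed, by changing the sign of the Hamiltonian.) -/
def leaf (P : PoissonBracket n M) (q : M) : Set M :=
  {p | Relation.ReflTransGen P.HamiltonianStep q p}

/-- `L` is an embedded `d`-dimensional submanifold of `M` that is an integral manifold of the
distribution `D`: around each of its points it is a `d`-dimensional slice of a chart of `M`, and its
tangent spaces are the spaces `D x`. -/
def IsIntegralSubmanifold (D : ∀ x : M, Submodule ℝ (TangentSpace (𝓡 n) x)) (d : ℕ)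
    (L : Set M) : Prop :=
  ∀ p ∈ L, ∃ φ ∈ IsManifold.maximalAtlas (𝓡 n) ∞ M, p ∈ φ.source ∧
    ∃ W : Submodule ℝ (EuclideanSpace ℝ (Fin n)), Module.finrank ℝ W = d ∧
      ∀ x ∈ φ.source, (x ∈ L ↔ φ x - φ p ∈ W) ∧
        (x ∈ L → ∀ v : TangentSpace (𝓡 n) x, v ∈ D x ↔ mvfderiv (𝓡 n) φ x v ∈ W)

/-- `L` is a symplectic leaf of `P`, and it is a `d`-dimensional submanifold of `M` tangent to the
characteristic distribution. -/
def IsSymplecticLeaf (P : PoissonBracket n M) (d : ℕ) (L : Set M) : Prop :=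
  (∃ q, L = P.leaf q) ∧ IsIntegralSubmanifold P.charDist d L

end PoissonBracket

/-! ### Critical points, and the bracket defined by a map -/

/-- `L` is a connected component of the subspace `S`. -/
def IsComponentOf {X : Type*} [TopologicalSpace X] (L S : Set X) : Prop :=
  ∃ x ∈ S, L = connectedComponentIn S x

section Map

variable {m : ℕ} {M : Type*} [TopologicalSpace M]
  [ChartedSpace (EuclideanSpace ℝ (Fin (m + 2))) M]
  {N : Type*} [TopologicalSpace N] [ChartedSpace (EuclideanSpace ℝ (Fin m)) N]

/-- The set `C` of critical points of `f`: the points at which `df` is not surjective. -/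
def criticalSet (f : C^∞⟮𝓡 (m + 2), M; 𝓡 m, N⟯) : Set M :=
  {x | ¬ Function.Surjective (mfderiv (𝓡 (m + 2)) (𝓡 m) f x)}

/-- `s` is a singular (critical) value of `f`: the image of a critical point. The other points of
`N` are the regular values. -/
def IsSingularValue (f : C^∞⟮𝓡 (m + 2), M; 𝓡 m, N⟯) (s : N) : Prop :=
  ∃ x ∈ criticalSet f, f x = s

/-- The operation `br` on `C^∞(M)` satisfies `{g, h} μ = k dg ∧ dh ∧ f^*Ω`. -/
def SatisfiesFormula (μ : VolumeForm (m + 2) M) (Ω : VolumeForm m N)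
    (f : C^∞⟮𝓡 (m + 2), M; 𝓡 m, N⟯) (k : C^∞⟮𝓡 (m + 2), M; ℝ⟯)
    (br : C^∞⟮𝓡 (m + 2), M; ℝ⟯ → C^∞⟮𝓡 (m + 2), M; ℝ⟯ → C^∞⟮𝓡 (m + 2), M; ℝ⟯) : Prop :=
  ∀ (g h : C^∞⟮𝓡 (m + 2), M; ℝ⟯) (x : M),
    br g h x • μ.toForm x =
      k x • covectorWedge (mvfderiv (𝓡 (m + 2)) g x).toLinearMap
        (covectorWedge (mvfderiv (𝓡 (m + 2)) h x).toLinearMap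
          ((Ω.toForm (f x)).compLinearMap
            (mfderiv (𝓡 (m + 2)) (𝓡 m) f x).toLinearMap))

end Map

end

/-! ### Decomposable forms of top degree -/

/-! At each point the ratio of `k α ∧ β ∧ f^*Ω` to `μ` is an alternating bilinear form `π` in the
covectors `α`, `β` (`bivector`). Existence and uniqueness of the bracket are therefore linear
algebra, and its smoothness follows from the coordinate expression, a Jacobian determinant times
smooth coefficients (`contMDiffAt_bivector`).

The rest depends on how `π` looks at the two kinds of points. At a critical point `π = 0`, because
`f^*Ω` vanishes there. Near a regular point `f` is a linear projection with two-dimensional kernel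
in suitable charts (`exists_isAdaptedChart`). Covectors pulled back by `df` are killed by `π`, so `π
= c ∂₁ ∧ ∂₂` along the fibres, with `c` nowhere zero (`IsAdaptedChart.bivector_comp`,
`IsAdaptedChart.planeCoeff_ne_zero`). The Jacobi identity is thus trivial on `C`, and elsewhere it
is the identity `jacobi_of_plane` for a bracket involving only two directions.

For the leaves, Hamiltonian vectors lie in `ker df`, so `f` is constant along trajectories. They
vanish on `C`, so by uniqueness of solutions a trajectory meeting `C` is constant. Hence a leaf is a
point of `C` or is contained in a component of a fibre minus `C`. Conversely, two points on one
slice of an adapted chart with convex image are joined by a straight segment that is a trajectory of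
an explicit Hamiltonian (`IsAdaptedChart.hamiltonianStep`). Connectedness spreads this over the
whole component (`jacobianPoisson_leaf_of_notMem`). It also shows that a leaf meeting such a chart
fills exactly one slice, so it is embedded. -/

section LinearAlgebra

variable {V : Type*} [AddCommGroup V] [Module ℝ V] {p : ℕ}

/-- The decomposable form `L₀ ∧ ⋯ ∧ L_{p-1}`. -/
noncomputable def covectorDet (L : Fin p → V →ₗ[ℝ] ℝ) : V [⋀^Fin p]→ₗ[ℝ] ℝ :=
  Matrix.detRowAlternating.compLinearMap (LinearMap.pi L)

lemma covectorDet_apply (L : Fin p → V →ₗ[ℝ] ℝ) (v : Fin p → V) :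
    covectorDet L v = Matrix.det (Matrix.of fun i j => L j (v i)) := rfl

/-- Laplace expansion of the determinant along its first column. -/
lemma covectorWedge_covectorDet (α : V →ₗ[ℝ] ℝ) (L : Fin p → V →ₗ[ℝ] ℝ) :
    covectorWedge α (covectorDet L) = covectorDet (Fin.cons α L : Fin (p + 1) → V →ₗ[ℝ] ℝ) := by
  ext v
  rw [covectorDet_apply, Matrix.det_succ_column_zero, covectorWedge,
    AlternatingMap.alternatizeUncurryFin_apply]
  refine Finset.sum_congr rfl fun i _ => ?_
  simp only [LinearMap.smulRight_apply, AlternatingMap.smul_apply, covectorDet_apply,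
    zsmul_eq_mul, smul_eq_mul, Matrix.of_apply, Fin.cons_zero]
  push_cast
  rw [mul_assoc]
  rfl

lemma covectorWedge_smul (α : V →ₗ[ℝ] ℝ) (c : ℝ) (η : V [⋀^Fin p]→ₗ[ℝ] ℝ) :
    covectorWedge α (c • η) = c • covectorWedge α η := by
  ext v
  simp only [covectorWedge, AlternatingMap.alternatizeUncurryFin_apply,
    LinearMap.smulRight_apply, AlternatingMap.smul_apply, Finset.smul_sum]
  refine Finset.sum_congr rfl fun i _ => ?_
  simp only [smul_eq_mul, zsmul_eq_mul]
  ring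

lemma covectorWedge_add_right (α : V →ₗ[ℝ] ℝ) (η ζ : V [⋀^Fin p]→ₗ[ℝ] ℝ) :
    covectorWedge α (η + ζ) = covectorWedge α η + covectorWedge α ζ := by
  rw [covectorWedge, covectorWedge, covectorWedge, ← AlternatingMap.alternatizeUncurryFin_add]
  congr 1
  ext v
  simp

lemma covectorWedge_add_left (α β : V →ₗ[ℝ] ℝ) (η : V [⋀^Fin p]→ₗ[ℝ] ℝ) :
    covectorWedge (α + β) η = covectorWedge α η + covectorWedge β η := by
  rw [covectorWedge, covectorWedge, covectorWedge, ← AlternatingMap.alternatizeUncurryFin_add]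
  congr 1
  ext v
  simp [add_mul]

lemma covectorWedge_smul_left (α : V →ₗ[ℝ] ℝ) (c : ℝ) (η : V [⋀^Fin p]→ₗ[ℝ] ℝ) :
    covectorWedge (c • α) η = c • covectorWedge α η := by
  rw [covectorWedge, covectorWedge, ← AlternatingMap.alternatizeUncurryFin_smul]
  congr 1
  ext v
  simp [mul_assoc]

/-- A linear relation among the covectors is a kernel vector of every matrix `L j (v i)`. -/
lemma covectorDet_eq_zero {L : Fin p → V →ₗ[ℝ] ℝ} (c : Fin p → ℝ) (hc : c ≠ 0)
    (h : ∀ v, ∑ j, L j v * c j = 0) : covectorDet L = 0 := by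
  ext v
  rw [covectorDet_apply, AlternatingMap.zero_apply, ← Matrix.exists_mulVec_eq_zero_iff]
  exact ⟨c, hc, funext fun i => by simpa [Matrix.mulVec, dotProduct] using h (v i)⟩

/-- A kernel vector of the matrix on a basis would be a relation holding on that basis, hence
everywhere. -/
lemma covectorDet_ne_zero {L : Fin p → V →ₗ[ℝ] ℝ} (b : Module.Basis (Fin p) ℝ V)
    (h : ∀ c : Fin p → ℝ, (∀ v, ∑ j, L j v * c j = 0) → c = 0) : covectorDet L b ≠ 0 := by
  intro h0
  rw [covectorDet_apply, ← Matrix.exists_mulVec_eq_zero_iff] at h0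
  obtain ⟨c, hc, hc'⟩ := h0
  refine hc (h c fun v => ?_)
  have hl : (∑ j, c j • L j) = 0 := b.ext fun i => by
    have := congrFun hc' i
    simpa [Matrix.mulVec, dotProduct, mul_comm] using this
  have := LinearMap.congr_fun hl v
  simpa [mul_comm] using this

/-- Top degree forms are a line, and `covectorDet L` takes the value 1 on the basis dual to `L`. -/
lemma AlternatingMap.eq_apply_smul_covectorDet (Ω : V [⋀^Fin p]→ₗ[ℝ] ℝ)
    (b : Module.Basis (Fin p) ℝ V) (L : Fin p → V →ₗ[ℝ] ℝ)
    (h : ∀ i j, L j (b i) = if i = j then 1 else 0) : Ω = Ω b • covectorDet L := by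
  have h1 : covectorDet L b = 1 := by
    rw [covectorDet_apply, ← Matrix.det_one (R := ℝ) (n := Fin p)]
    congr 1
    ext i j
    simp [h, Matrix.one_apply]
  have h2 := (covectorDet L).eq_smul_basis_det b
  rw [h1, one_smul] at h2
  rw [h2]
  exact Ω.eq_smul_basis_det b

lemma AlternatingMap.smul_eq_smul_of_apply_basis {μ ν : V [⋀^Fin p]→ₗ[ℝ] ℝ}
    (b : Module.Basis (Fin p) ℝ V) {c d : ℝ} (h : c * μ b = d * ν b) : c • μ = d • ν := by
  rw [μ.eq_smul_basis_det b, ν.eq_smul_basis_det b, smul_smul, smul_smul, h]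

lemma AlternatingMap.apply_basis_ne_zero {μ : V [⋀^Fin p]→ₗ[ℝ] ℝ}
    (b : Module.Basis (Fin p) ℝ V) (h : μ ≠ 0) : μ b ≠ 0 := fun h0 => h <| by
  rw [μ.eq_smul_basis_det b, h0, zero_smul]

variable {V' : Type*} [AddCommGroup V'] [Module ℝ V']

lemma covectorWedge_covectorWedge_comp {Ω : V' [⋀^Fin p]→ₗ[ℝ] ℝ} {c : ℝ}
    {L : Fin p → V' →ₗ[ℝ] ℝ} (hΩ : Ω = c • covectorDet L) (α β : V →ₗ[ℝ] ℝ) (A : V →ₗ[ℝ] V') :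
    covectorWedge α (covectorWedge β (Ω.compLinearMap A)) =
      c • covectorDet (Fin.cons α (Fin.cons β fun j => L j ∘ₗ A : Fin (p + 1) → V →ₗ[ℝ] ℝ) :
        Fin (p + 2) → V →ₗ[ℝ] ℝ) := by
  have h : Ω.compLinearMap A = c • covectorDet fun j => L j ∘ₗ A := by
    rw [hΩ]
    rfl
  rw [h, covectorWedge_smul, covectorWedge_smul, covectorWedge_covectorDet,
    covectorWedge_covectorDet]

lemma Module.Basis.coord_apply_self (b : Module.Basis (Fin p) ℝ V') (i j : Fin p) :
    b.coord j (b i) = if i = j then 1 else 0 := by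
  simp [Finsupp.single_apply]

lemma Module.Basis.apply_eq_sum_coord (b : Module.Basis (Fin p) ℝ V') (β : V' →ₗ[ℝ] ℝ) (u : V') :
    β u = ∑ j, b.coord j u * β (b j) := by
  conv_lhs => rw [← b.sum_repr u]
  simp only [map_sum, map_smul, smul_eq_mul, Module.Basis.coord_apply]

/-- The basis `b` serves to make `Ω` decomposable; the factor `α` then occurs twice. -/
lemma covectorWedge_self (b : Module.Basis (Fin p) ℝ V') (α : V →ₗ[ℝ] ℝ) (A : V →ₗ[ℝ] V')
    (Ω : V' [⋀^Fin p]→ₗ[ℝ] ℝ) : covectorWedge α (covectorWedge α (Ω.compLinearMap A)) = 0 := by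
  rw [covectorWedge_covectorWedge_comp
    (Ω.eq_apply_smul_covectorDet b b.coord b.coord_apply_self),
    covectorDet_eq_zero (Fin.cons 1 (Fin.cons (-1) 0)) (fun h => by simpa using congrFun h 0),
    smul_zero]
  intro v
  simp [Fin.sum_univ_succ]

/-- The pulled back covector is a combination of the factors `b.coord j ∘ A` of the pulled back
form. This makes functions of `f` Casimirs. -/
lemma covectorWedge_comp (b : Module.Basis (Fin p) ℝ V') (α : V →ₗ[ℝ] ℝ) (A : V →ₗ[ℝ] V')
    (β : V' →ₗ[ℝ] ℝ) (Ω : V' [⋀^Fin p]→ₗ[ℝ] ℝ) :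
    covectorWedge α (covectorWedge (β ∘ₗ A) (Ω.compLinearMap A)) = 0 := by
  rw [covectorWedge_covectorWedge_comp
    (Ω.eq_apply_smul_covectorDet b b.coord b.coord_apply_self),
    covectorDet_eq_zero (Fin.cons 0 (Fin.cons (-1) (β ∘ b)))
      (fun h => by simpa using congrFun h 1), smul_zero]
  intro v
  have : β (A v) = ∑ j, b.coord j (A v) * β (b j) := b.apply_eq_sum_coord β (A v)
  simp [Fin.sum_univ_succ, this]

/-- A nonzero functional vanishing on the range of `A` is a relation among the covectors `b.coord j
∘ A`. -/
lemma covectorWedge_eq_zero_of_not_surjective (b : Module.Basis (Fin p) ℝ V') {A : V →ₗ[ℝ] V'}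
    (hA : ¬ Function.Surjective A) (α β : V →ₗ[ℝ] ℝ) (Ω : V' [⋀^Fin p]→ₗ[ℝ] ℝ) :
    covectorWedge α (covectorWedge β (Ω.compLinearMap A)) = 0 := by
  rw [← LinearMap.range_eq_top] at hA
  obtain ⟨l, hl, hl'⟩ := Submodule.exists_le_ker_of_lt_top _ (lt_top_iff_ne_top.2 hA)
  rw [covectorWedge_covectorWedge_comp
    (Ω.eq_apply_smul_covectorDet b b.coord b.coord_apply_self),
    covectorDet_eq_zero (Fin.cons 0 (Fin.cons 0 (l ∘ b))), smul_zero]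
  · intro h
    refine hl (b.ext fun i => ?_)
    simpa using congrFun h i.succ.succ
  · intro v
    have h0 : l (A v) = 0 := hl' ⟨v, rfl⟩
    have : l (A v) = ∑ j, b.coord j (A v) * l (b j) := b.apply_eq_sum_coord l (A v)
    simpa [Fin.sum_univ_succ, h0] using this.symm

/-- The factors are independent: evaluating a relation at `v` and `w` kills the first two
coefficients, and evaluating it at lifts of the `b i` kills the others. -/
lemma covectorWedge_ne_zero_of_surjective (b : Module.Basis (Fin p) ℝ V')
    (b' : Module.Basis (Fin (p + 2)) ℝ V) {A : V →ₗ[ℝ] V'}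
    (hA : Function.Surjective A) {α β : V →ₗ[ℝ] ℝ} {Ω : V' [⋀^Fin p]→ₗ[ℝ] ℝ} (hΩ : Ω ≠ 0)
    {v w : V} (hv : A v = 0) (hw : A w = 0) (hαv : α v = 1) (hαw : α w = 0) (hβv : β v = 0)
    (hβw : β w = 1) : covectorWedge α (covectorWedge β (Ω.compLinearMap A)) b' ≠ 0 := by
  rw [covectorWedge_covectorWedge_comp
    (Ω.eq_apply_smul_covectorDet b b.coord b.coord_apply_self),
    AlternatingMap.smul_apply]
  refine smul_ne_zero (AlternatingMap.apply_basis_ne_zero b hΩ) (covectorDet_ne_zero b' fun c hc => ?_)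
  have h0 : c 0 = 0 := by simpa [Fin.sum_univ_succ, hv, hαv, hβv] using hc v
  have h1 : c 1 = 0 := by simpa [Fin.sum_univ_succ, hw, hαw, hβw] using hc w
  funext i
  refine Fin.cases h0 (fun i => Fin.cases h1 (fun i => ?_) i) i
  obtain ⟨u, hu⟩ := hA (b i)
  have h1' : c (Fin.succ 0) = 0 := h1
  simpa [Fin.sum_univ_succ, h0, h1, h1', hu, Finsupp.single_apply] using hc u

end LinearAlgebra

/-! ### Derivatives and volume forms in charts -/

section Charts

variable {n : ℕ} {M : Type*} [TopologicalSpace M] [ChartedSpace (EuclideanSpace ℝ (Fin n)) M]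

lemma mdifferentiable_of_mem_maximalAtlas
    {φ : OpenPartialHomeomorph M (EuclideanSpace ℝ (Fin n))}
    (hφ : φ ∈ IsManifold.maximalAtlas (𝓡 n) ∞ M) : φ.MDifferentiable (𝓡 n) (𝓡 n) :=
  ⟨(contMDiffOn_of_mem_maximalAtlas hφ).mdifferentiableOn (by simp),
    (contMDiffOn_symm_of_mem_maximalAtlas hφ).mdifferentiableOn (by simp)⟩

lemma contDiffAt_comp_chart_symm {φ : OpenPartialHomeomorph M (EuclideanSpace ℝ (Fin n))}
    (hφ : φ ∈ IsManifold.maximalAtlas (𝓡 n) ∞ M) {y : EuclideanSpace ℝ (Fin n)}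
    (hy : y ∈ φ.target) {F : Type*} [NormedAddCommGroup F] [NormedSpace ℝ F] {g : M → F}
    (hg : ContMDiffAt (𝓡 n) 𝓘(ℝ, F) ∞ g (φ.symm y)) : ContDiffAt ℝ ∞ (g ∘ φ.symm) y :=
  contMDiffAt_iff_contDiffAt.1 (hg.comp y (contMDiffAt_symm_of_mem_maximalAtlas hφ hy))

lemma mvfderiv_clm_comp_chart {φ : OpenPartialHomeomorph M (EuclideanSpace ℝ (Fin n))}
    (hφ : φ ∈ IsManifold.maximalAtlas (𝓡 n) ∞ M) {x : M}
    (hx : x ∈ φ.source) (α : EuclideanSpace ℝ (Fin n) →L[ℝ] ℝ) :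
    mvfderiv (𝓡 n) (α ∘ φ) x = α ∘L mvfderiv (𝓡 n) φ x := by
  have hφd := (mdifferentiable_of_mem_maximalAtlas hφ).mdifferentiableAt hx
  have h := mfderiv_comp x (α.differentiableAt (x := φ x)).mdifferentiableAt hφd
  rw [mfderiv_eq_fderiv, ContinuousLinearMap.fderiv] at h
  exact h

lemma contMDiffAt_of_comp_chart_symm {φ : OpenPartialHomeomorph M (EuclideanSpace ℝ (Fin n))}
    (hφ : φ ∈ IsManifold.maximalAtlas (𝓡 n) ∞ M) {x : M}
    (hx : x ∈ φ.source) {F : Type*} [NormedAddCommGroup F] [NormedSpace ℝ F] {g : M → F}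
    (hg : ContDiffAt ℝ ∞ (g ∘ φ.symm) (φ x)) : ContMDiffAt (𝓡 n) 𝓘(ℝ, F) ∞ g x := by
  have h := (contMDiffAt_iff_contDiffAt.2 hg).comp x (contMDiffAt_of_mem_maximalAtlas hφ hx)
  refine h.congr_of_eventuallyEq ?_
  filter_upwards [φ.open_source.mem_nhds hx] with z hz
  simp [φ.left_inv hz]

lemma VolumeForm.contDiffAt_coordBasis (μ : VolumeForm n M) (x₀ : M)
    (v : Fin n → EuclideanSpace ℝ (Fin n)) {y : EuclideanSpace ℝ (Fin n)}
    (hy : y ∈ (chartAt (EuclideanSpace ℝ (Fin n)) x₀).target) :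
    ContDiffAt ℝ ∞ (fun y => μ.toForm ((chartAt (EuclideanSpace ℝ (Fin n)) x₀).symm y) fun i =>
      mfderiv (𝓡 n) (𝓡 n) (chartAt (EuclideanSpace ℝ (Fin n)) x₀).symm y (v i)) y := by
  have h := μ.smooth x₀ v
  have ht : (extChartAt (𝓡 n) x₀).target = (chartAt (EuclideanSpace ℝ (Fin n)) x₀).target := by
    simp [mfld_simps]
  rw [ht] at h
  exact h.contDiffAt ((chartAt (EuclideanSpace ℝ (Fin n)) x₀).open_target.mem_nhds hy)

lemma mvfderiv_mfderiv_chart_symm {φ : OpenPartialHomeomorph M (EuclideanSpace ℝ (Fin n))}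
    (hφ : φ ∈ IsManifold.maximalAtlas (𝓡 n) ∞ M) {y : EuclideanSpace ℝ (Fin n)}
    (hy : y ∈ φ.target) {F : Type*} [NormedAddCommGroup F] [NormedSpace ℝ F] {g : M → F}
    (hg : MDifferentiableAt (𝓡 n) 𝓘(ℝ, F) g (φ.symm y)) (v : EuclideanSpace ℝ (Fin n)) :
    mvfderiv (𝓡 n) g (φ.symm y) (mfderiv (𝓡 n) (𝓡 n) φ.symm y v) =
      fderiv ℝ (g ∘ φ.symm) y v := by
  have h := mfderiv_comp y hg ((mdifferentiable_of_mem_maximalAtlas hφ).mdifferentiableAt_symm hy)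
  rw [mfderiv_eq_fderiv] at h
  rw [h]
  rfl

lemma mvfderiv_eq_fderiv_comp_mfderiv {φ : OpenPartialHomeomorph M (EuclideanSpace ℝ (Fin n))}
    (hφ : φ ∈ IsManifold.maximalAtlas (𝓡 n) ∞ M) {x : M} (hx : x ∈ φ.source)
    {F : Type*} [NormedAddCommGroup F] [NormedSpace ℝ F] {g : M → F}
    (hg : MDifferentiableAt (𝓡 n) 𝓘(ℝ, F) g x) (v : TangentSpace (𝓡 n) x) :
    mvfderiv (𝓡 n) g x v = fderiv ℝ (g ∘ φ.symm) (φ x) (mvfderiv (𝓡 n) φ x v) := by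
  have hy := φ.map_source hx
  have h := mvfderiv_mfderiv_chart_symm hφ hy (g := g) (by rwa [φ.left_inv hx])
    (mvfderiv (𝓡 n) φ x v)
  rw [← h]
  have h2 := (mdifferentiable_of_mem_maximalAtlas hφ).symm_comp_deriv hx
  have h3 : mfderiv (𝓡 n) (𝓡 n) φ.symm (φ x) (mvfderiv (𝓡 n) φ x v) = v :=
    DFunLike.congr_fun h2 v
  rw [h3, φ.left_inv hx]

lemma eventually_mdifferentiableAt_of_contMDiffAt [IsManifold (𝓡 n) ∞ M] {F : Type*}
    [NormedAddCommGroup F] [NormedSpace ℝ F] {g : M → F} {x : M}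
    (hg : ContMDiffAt (𝓡 n) 𝓘(ℝ, F) ∞ g x) :
    ∀ᶠ z in nhds x, MDifferentiableAt (𝓡 n) 𝓘(ℝ, F) g z := by
  have : IsManifold (𝓡 n) 1 M := IsManifold.of_le (n := ∞) (by simp)
  -- Being C^r at a point passes to nearby points for finite `r`, not for `r = ∞`, so only order 1
  -- is used.
  exact ((contMDiffAt_iff_contMDiffAt_nhds (by simp)).1
    (hg.of_le (by simp : (1 : WithTop ℕ∞) ≤ ∞))).mono fun z hz => hz.mdifferentiableAt (by simp)

variable (n) in
/-- The standard basis of the model space, as a basis of a tangent space. -/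
noncomputable def tangentBasis (x : M) : Module.Basis (Fin n) ℝ (TangentSpace (𝓡 n) x) :=
  (EuclideanSpace.basisFun (Fin n) ℝ).toBasis

/-- The basis of coordinate vectors of a chart. -/
noncomputable def coordBasis {φ : OpenPartialHomeomorph M (EuclideanSpace ℝ (Fin n))}
    (hφ : φ ∈ IsManifold.maximalAtlas (𝓡 n) ∞ M) {y : EuclideanSpace ℝ (Fin n)}
    (hy : y ∈ φ.target) : Module.Basis (Fin n) ℝ (TangentSpace (𝓡 n) (φ.symm y)) :=
  (tangentBasis n y).map
    (LinearEquiv.ofBijective (mfderiv (𝓡 n) (𝓡 n) φ.symm y).toLinearMap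
      ((mdifferentiable_of_mem_maximalAtlas hφ).symm.mfderiv_bijective hy))

lemma coordBasis_apply {φ : OpenPartialHomeomorph M (EuclideanSpace ℝ (Fin n))}
    (hφ : φ ∈ IsManifold.maximalAtlas (𝓡 n) ∞ M) {y : EuclideanSpace ℝ (Fin n)}
    (hy : y ∈ φ.target) (i : Fin n) :
    coordBasis hφ hy i = mfderiv (𝓡 n) (𝓡 n) φ.symm y (EuclideanSpace.basisFun (Fin n) ℝ i) := by
  rw [coordBasis, Module.Basis.map_apply]
  exact congrArg (mfderiv (𝓡 n) (𝓡 n) φ.symm y)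
    (congrFun (EuclideanSpace.basisFun (Fin n) ℝ).coe_toBasis i)

lemma mvfderiv_chart_coordBasis {φ : OpenPartialHomeomorph M (EuclideanSpace ℝ (Fin n))}
    (hφ : φ ∈ IsManifold.maximalAtlas (𝓡 n) ∞ M) {y : EuclideanSpace ℝ (Fin n)}
    (hy : y ∈ φ.target) (i j : Fin n) :
    mvfderiv (𝓡 n) φ (φ.symm y) (coordBasis hφ hy i) j = if i = j then 1 else 0 := by
  have h := (mdifferentiable_of_mem_maximalAtlas hφ).comp_symm_deriv hy
  have h2 : mvfderiv (𝓡 n) φ (φ.symm y) (coordBasis hφ hy i) = EuclideanSpace.basisFun (Fin n) ℝ i :=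
    by rw [coordBasis_apply]; exact DFunLike.congr_fun h _
  rw [h2]
  simp [eq_comm]

end Charts

lemma ContDiffAt.matrix_det {E : Type*} [NormedAddCommGroup E] [NormedSpace ℝ E] {p : ℕ}
    {A : E → Matrix (Fin p) (Fin p) ℝ} {y : E} {r : WithTop ℕ∞}
    (h : ∀ i j, ContDiffAt ℝ r (fun z => A z i j) y) : ContDiffAt ℝ r (fun z => (A z).det) y := by
  simp only [Matrix.det_apply, Units.smul_def, zsmul_eq_mul]
  exact ContDiffAt.sum fun σ _ => contDiffAt_const.mul (contDiffAt_prod fun i _ => h _ _)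

section VolumeForm

variable {m : ℕ} {N : Type*} [TopologicalSpace N] [ChartedSpace (EuclideanSpace ℝ (Fin m)) N]

/-- The coordinate vectors and the coordinate differentials are dual bases. The coefficient is a
function of `ψ s` that is smooth when `ψ` is one of the charts of the atlas. -/
lemma VolumeForm.toForm_eq_smul_covectorDet (Ω : VolumeForm m N)
    {ψ : OpenPartialHomeomorph N (EuclideanSpace ℝ (Fin m))}
    (hψ : ψ ∈ IsManifold.maximalAtlas (𝓡 m) ∞ N) {s : N} (hs : s ∈ ψ.source) :
    Ω.toForm s = Ω.toForm (ψ.symm (ψ s)) (fun i => mfderiv (𝓡 m) (𝓡 m) ψ.symm (ψ s)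
      (EuclideanSpace.basisFun (Fin m) ℝ i)) • covectorDet fun j =>
        ((EuclideanSpace.proj j : EuclideanSpace ℝ (Fin m) →L[ℝ] ℝ) ∘L
          mvfderiv (𝓡 m) ψ s).toLinearMap := by
  obtain ⟨z, hz, rfl⟩ : ∃ z ∈ ψ.target, ψ.symm z = s := ⟨ψ s, ψ.map_source hs, ψ.left_inv hs⟩
  rw [ψ.right_inv hz]
  have h : (fun i => mfderiv (𝓡 m) (𝓡 m) ψ.symm z (EuclideanSpace.basisFun (Fin m) ℝ i)) =
      coordBasis hψ hz := funext fun i => (coordBasis_apply hψ hz i).symm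
  rw [h]
  exact AlternatingMap.eq_apply_smul_covectorDet _ _ _ fun i j =>
    mvfderiv_chart_coordBasis hψ hz i j

end VolumeForm

/-! ### The bivector and the smoothness of the bracket -/

section Bivector

variable {m : ℕ} {M : Type*} [TopologicalSpace M]
  [ChartedSpace (EuclideanSpace ℝ (Fin (m + 2))) M]
  {N : Type*} [TopologicalSpace N] [ChartedSpace (EuclideanSpace ℝ (Fin m)) N]
  (μ : VolumeForm (m + 2) M) (Ω : VolumeForm m N)
  (f : C^∞⟮𝓡 (m + 2), M; 𝓡 m, N⟯) (k : C^∞⟮𝓡 (m + 2), M; ℝ⟯)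

/-- The top degree form `α ∧ β ∧ f^*Ω` at a point. -/
noncomputable def wedgePullback (x : M) (α β : TangentSpace (𝓡 (m + 2)) x →L[ℝ] ℝ) :
    (TangentSpace (𝓡 (m + 2)) x) [⋀^Fin (m + 2)]→ₗ[ℝ] ℝ :=
  covectorWedge α.toLinearMap (covectorWedge β.toLinearMap
    ((Ω.toForm (f x)).compLinearMap (mfderiv (𝓡 (m + 2)) (𝓡 m) f x).toLinearMap))

/-- The bivector `π` with `π(α, β) μ = k α ∧ β ∧ f^*Ω`. -/
noncomputable def bivector (x : M) : (TangentSpace (𝓡 (m + 2)) x →L[ℝ] ℝ) →ₗ[ℝ]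
    (TangentSpace (𝓡 (m + 2)) x →L[ℝ] ℝ) →ₗ[ℝ] ℝ :=
  -- The ratio of two top degree forms is the same on every basis, so it does not matter that the
  -- model basis need not be a smooth frame.
  LinearMap.mk₂ ℝ (fun α β => k x * wedgePullback Ω f x α β (tangentBasis (m + 2) x) /
      μ.toForm x (tangentBasis (m + 2) x))
    (fun α α' β => by
      simp only [wedgePullback, ContinuousLinearMap.toLinearMap_add, covectorWedge_add_left,
        AlternatingMap.add_apply]
      ring)
    (fun c α β => by
      simp only [wedgePullback, ContinuousLinearMap.toLinearMap_smul, covectorWedge_smul_left,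
        AlternatingMap.smul_apply, smul_eq_mul]
      ring)
    (fun α β β' => by
      simp only [wedgePullback, ContinuousLinearMap.toLinearMap_add, covectorWedge_add_left,
        covectorWedge_add_right, AlternatingMap.add_apply]
      ring)
    (fun c α β => by
      simp only [wedgePullback, ContinuousLinearMap.toLinearMap_smul, covectorWedge_smul_left,
        covectorWedge_smul, AlternatingMap.smul_apply, smul_eq_mul]
      ring)

lemma bivector_apply (x : M) (α β : TangentSpace (𝓡 (m + 2)) x →L[ℝ] ℝ) :
    bivector μ Ω f k x α β = k x * wedgePullback Ω f x α β (tangentBasis (m + 2) x) /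
      μ.toForm x (tangentBasis (m + 2) x) := rfl

lemma bivector_smul_toForm (x : M) (α β : TangentSpace (𝓡 (m + 2)) x →L[ℝ] ℝ) :
    bivector μ Ω f k x α β • μ.toForm x = k x • wedgePullback Ω f x α β := by
  refine AlternatingMap.smul_eq_smul_of_apply_basis (tangentBasis (m + 2) x) ?_
  rw [bivector_apply, div_mul_cancel₀]
  exact AlternatingMap.apply_basis_ne_zero _ (μ.ne_zero x)

lemma bivector_self (x : M) (α : TangentSpace (𝓡 (m + 2)) x →L[ℝ] ℝ) :
    bivector μ Ω f k x α α = 0 := by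
  rw [bivector_apply, wedgePullback, covectorWedge_self (tangentBasis m (f x))]
  simp

lemma bivector_swap (x : M) (α β : TangentSpace (𝓡 (m + 2)) x →L[ℝ] ℝ) :
    bivector μ Ω f k x α β = - bivector μ Ω f k x β α := by
  have h := bivector_self μ Ω f k x (α + β)
  simp only [map_add, LinearMap.add_apply, bivector_self] at h
  linarith

lemma bivector_comp_mfderiv_right (x : M) (α : TangentSpace (𝓡 (m + 2)) x →L[ℝ] ℝ)
    (β : TangentSpace (𝓡 m) (f x) →L[ℝ] ℝ) :
    bivector μ Ω f k x α (β ∘L mfderiv (𝓡 (m + 2)) (𝓡 m) f x) = 0 := by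
  rw [bivector_apply, wedgePullback, ContinuousLinearMap.toLinearMap_comp,
    covectorWedge_comp (tangentBasis m (f x))]
  simp

lemma bivector_comp_mfderiv_left (x : M) (α : TangentSpace (𝓡 (m + 2)) x →L[ℝ] ℝ)
    (β : TangentSpace (𝓡 m) (f x) →L[ℝ] ℝ) :
    bivector μ Ω f k x (β ∘L mfderiv (𝓡 (m + 2)) (𝓡 m) f x) α = 0 := by
  rw [bivector_swap, bivector_comp_mfderiv_right, neg_zero]

lemma bivector_eq_zero_of_mem_criticalSet {x : M} (hx : x ∈ criticalSet f)
    (α β : TangentSpace (𝓡 (m + 2)) x →L[ℝ] ℝ) : bivector μ Ω f k x α β = 0 := by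
  rw [bivector_apply, wedgePullback,
    covectorWedge_eq_zero_of_not_surjective (tangentBasis m (f x)) hx]
  simp

lemma bivector_ne_zero {x : M} (hk : k x ≠ 0) (hx : x ∉ criticalSet f)
    {α β : TangentSpace (𝓡 (m + 2)) x →L[ℝ] ℝ} {v w : TangentSpace (𝓡 (m + 2)) x}
    (hv : mfderiv (𝓡 (m + 2)) (𝓡 m) f x v = 0) (hw : mfderiv (𝓡 (m + 2)) (𝓡 m) f x w = 0)
    (hαv : α v = 1) (hαw : α w = 0) (hβv : β v = 0) (hβw : β w = 1) :
    bivector μ Ω f k x α β ≠ 0 := by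
  rw [bivector_apply]
  refine div_ne_zero (mul_ne_zero hk ?_) (AlternatingMap.apply_basis_ne_zero _ (μ.ne_zero x))
  exact covectorWedge_ne_zero_of_surjective (tangentBasis m (f x)) _ (not_not.1 hx)
    (Ω.ne_zero (f x)) hv hw hαv hαw hβv hβw

/-- In coordinates, the coefficient of `dg ∧ dh ∧ f^*Ω` is a Jacobian determinant. -/
lemma wedgePullback_coordBasis {φ : OpenPartialHomeomorph M (EuclideanSpace ℝ (Fin (m + 2)))}
    (hφ : φ ∈ IsManifold.maximalAtlas (𝓡 (m + 2)) ∞ M)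
    {ψ : OpenPartialHomeomorph N (EuclideanSpace ℝ (Fin m))}
    (hψ : ψ ∈ IsManifold.maximalAtlas (𝓡 m) ∞ N) {y : EuclideanSpace ℝ (Fin (m + 2))}
    (hy : y ∈ φ.target) (hfy : f (φ.symm y) ∈ ψ.source) {g h : M → ℝ}
    (hg : MDifferentiableAt (𝓡 (m + 2)) 𝓘(ℝ, ℝ) g (φ.symm y))
    (hh : MDifferentiableAt (𝓡 (m + 2)) 𝓘(ℝ, ℝ) h (φ.symm y)) :
    wedgePullback Ω f (φ.symm y) (mvfderiv (𝓡 (m + 2)) g (φ.symm y))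
        (mvfderiv (𝓡 (m + 2)) h (φ.symm y)) (coordBasis hφ hy) =
      Ω.toForm (ψ.symm (ψ (f (φ.symm y)))) (fun i => mfderiv (𝓡 m) (𝓡 m) ψ.symm
        (ψ (f (φ.symm y))) (EuclideanSpace.basisFun (Fin m) ℝ i)) *
      Matrix.det (Matrix.of fun i j => (Fin.cons
        (fderiv ℝ (g ∘ φ.symm) y (EuclideanSpace.basisFun (Fin (m + 2)) ℝ i))
        (Fin.cons (fderiv ℝ (h ∘ φ.symm) y (EuclideanSpace.basisFun (Fin (m + 2)) ℝ i))
          fun l => fderiv ℝ ((ψ ∘ f) ∘ φ.symm) y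
            (EuclideanSpace.basisFun (Fin (m + 2)) ℝ i) l : Fin (m + 1) → ℝ) :
          Fin (m + 2) → ℝ) j) := by
  have hff : MDifferentiableAt (𝓡 (m + 2)) (𝓡 m) f (φ.symm y) :=
    f.contMDiff.mdifferentiableAt (by simp)
  have hψd : MDifferentiableAt (𝓡 m) (𝓡 m) ψ (f (φ.symm y)) :=
    (mdifferentiable_of_mem_maximalAtlas hψ).mdifferentiableAt hfy
  have hψf : mvfderiv (𝓡 (m + 2)) (ψ ∘ f) (φ.symm y) =
      mvfderiv (𝓡 m) ψ (f (φ.symm y)) ∘L mfderiv (𝓡 (m + 2)) (𝓡 m) f (φ.symm y) :=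
    mfderiv_comp (φ.symm y) hψd hff
  rw [wedgePullback, covectorWedge_covectorWedge_comp (Ω.toForm_eq_smul_covectorDet hψ hfy),
    AlternatingMap.smul_apply, smul_eq_mul, covectorDet_apply]
  congr 3
  ext i j
  refine Fin.cases ?_ (fun j => Fin.cases ?_ (fun j => ?_) j) j
  · simp only [Fin.cons_zero, coordBasis_apply]
    exact mvfderiv_mfderiv_chart_symm hφ hy hg _
  · simp only [Fin.cons_zero, Fin.cons_succ, coordBasis_apply]
    exact mvfderiv_mfderiv_chart_symm hφ hy hh _
  · simp only [Fin.cons_succ, coordBasis_apply]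
    rw [← mvfderiv_mfderiv_chart_symm hφ hy (hψd.comp _ hff), hψf]
    rfl

variable [IsManifold (𝓡 (m + 2)) ∞ M] [IsManifold (𝓡 m) ∞ N]

/-- The bracket of two functions that are smooth at a point is smooth at that point. -/
lemma contMDiffAt_bivector {x₀ : M} {g h : M → ℝ}
    (hg : ContMDiffAt (𝓡 (m + 2)) 𝓘(ℝ, ℝ) ∞ g x₀) (hh : ContMDiffAt (𝓡 (m + 2)) 𝓘(ℝ, ℝ) ∞ h x₀) :
    ContMDiffAt (𝓡 (m + 2)) 𝓘(ℝ, ℝ) ∞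
      (fun x => bivector μ Ω f k x (mvfderiv (𝓡 (m + 2)) g x) (mvfderiv (𝓡 (m + 2)) h x)) x₀ := by
  set φ := chartAt (EuclideanSpace ℝ (Fin (m + 2))) x₀ with hφ_def
  set ψ := chartAt (EuclideanSpace ℝ (Fin m)) (f x₀) with hψ_def
  have hφ : φ ∈ IsManifold.maximalAtlas (𝓡 (m + 2)) ∞ M := IsManifold.chart_mem_maximalAtlas x₀
  have hψ : ψ ∈ IsManifold.maximalAtlas (𝓡 m) ∞ N := IsManifold.chart_mem_maximalAtlas (f x₀)
  have hx₀ : x₀ ∈ φ.source := mem_chart_source _ x₀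
  have hy₀ : φ x₀ ∈ φ.target := φ.map_source hx₀
  have hfx₀ : f x₀ ∈ ψ.source := mem_chart_source _ _
  have hsymm : φ.symm (φ x₀) = x₀ := φ.left_inv hx₀
  refine contMDiffAt_of_comp_chart_symm hφ hx₀ ?_
  have hcont : Filter.Tendsto φ.symm (nhds (φ x₀)) (nhds x₀) := by
    simpa [ContinuousAt, hsymm] using φ.symm.continuousAt hy₀
  have hφt : ∀ᶠ y in nhds (φ x₀), y ∈ φ.target := φ.open_target.mem_nhds hy₀
  have hψs : ∀ᶠ y in nhds (φ x₀), f (φ.symm y) ∈ ψ.source :=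
    (f.contMDiff.continuous.continuousAt.tendsto.comp hcont).eventually
      (ψ.open_source.mem_nhds hfx₀)
  have hgd : ∀ᶠ y in nhds (φ x₀), MDifferentiableAt (𝓡 (m + 2)) 𝓘(ℝ, ℝ) g (φ.symm y) :=
    hcont.eventually (eventually_mdifferentiableAt_of_contMDiffAt hg)
  have hhd : ∀ᶠ y in nhds (φ x₀), MDifferentiableAt (𝓡 (m + 2)) 𝓘(ℝ, ℝ) h (φ.symm y) :=
    hcont.eventually (eventually_mdifferentiableAt_of_contMDiffAt hh)
  have hG : ContDiffAt ℝ ∞ (g ∘ φ.symm) (φ x₀) :=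
    contDiffAt_comp_chart_symm hφ hy₀ (by rwa [hsymm])
  have hH : ContDiffAt ℝ ∞ (h ∘ φ.symm) (φ x₀) :=
    contDiffAt_comp_chart_symm hφ hy₀ (by rwa [hsymm])
  have hK : ContDiffAt ℝ ∞ (k ∘ φ.symm) (φ x₀) :=
    contDiffAt_comp_chart_symm hφ hy₀ k.contMDiff.contMDiffAt
  have hF : ContDiffAt ℝ ∞ ((ψ ∘ f) ∘ φ.symm) (φ x₀) :=
    contDiffAt_comp_chart_symm hφ hy₀ (by
      rw [hsymm]
      exact (contMDiffAt_of_mem_maximalAtlas hψ hfx₀).comp x₀ f.contMDiff.contMDiffAt)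
  have hμ := μ.contDiffAt_coordBasis x₀ (EuclideanSpace.basisFun (Fin (m + 2)) ℝ) hy₀
  have hz₀ : ((ψ ∘ f) ∘ φ.symm) (φ x₀) ∈ ψ.target := by
    rw [Function.comp_apply, hsymm]
    exact ψ.map_source hfx₀
  have hΩ := (Ω.contDiffAt_coordBasis (f x₀) (EuclideanSpace.basisFun (Fin m) ℝ) hz₀).comp _ hF
  have hfd : ∀ {F : Type} [NormedAddCommGroup F] [NormedSpace ℝ F]
      {G : EuclideanSpace ℝ (Fin (m + 2)) → F} (v : EuclideanSpace ℝ (Fin (m + 2))),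
      ContDiffAt ℝ ∞ G (φ x₀) → ContDiffAt ℝ ∞ (fun y => fderiv ℝ G y v) (φ x₀) :=
    fun v hG => (hG.fderiv_right (m := ∞) (by simp)).clm_apply contDiffAt_const
  have hdet : ContDiffAt ℝ ∞ (fun y => Matrix.det (Matrix.of fun i j => (Fin.cons
        (fderiv ℝ (g ∘ φ.symm) y (EuclideanSpace.basisFun (Fin (m + 2)) ℝ i))
        (Fin.cons (fderiv ℝ (h ∘ φ.symm) y (EuclideanSpace.basisFun (Fin (m + 2)) ℝ i))
          fun l => fderiv ℝ ((ψ ∘ f) ∘ φ.symm) y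
            (EuclideanSpace.basisFun (Fin (m + 2)) ℝ i) l : Fin (m + 1) → ℝ) :
          Fin (m + 2) → ℝ) j)) (φ x₀) := by
    refine ContDiffAt.matrix_det fun i j => ?_
    refine Fin.cases ?_ (fun j => Fin.cases ?_ (fun j => ?_) j) j
    · simpa only [Matrix.of_apply, Fin.cons_zero] using hfd _ hG
    · simpa only [Matrix.of_apply, Fin.cons_zero, Fin.cons_succ] using hfd _ hH
    · simp only [Matrix.of_apply, Fin.cons_succ]
      exact (EuclideanSpace.proj j : EuclideanSpace ℝ (Fin m) →L[ℝ] ℝ).contDiff.contDiffAt.comp _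
          (hfd _ hF)
  -- Near `φ x₀` the bracket is `k` times the coefficient of `Ω` times the Jacobian determinant,
  -- divided by the coefficient of `μ`.
  refine ((hK.mul (hΩ.mul hdet)).div hμ ?_).congr_of_eventuallyEq ?_
  · have := AlternatingMap.apply_basis_ne_zero (coordBasis hφ hy₀) (μ.ne_zero _)
    rwa [funext (coordBasis_apply hφ hy₀)] at this
  · filter_upwards [hφt, hψs, hgd, hhd] with y hy hfy hgy hhy
    have hμy := AlternatingMap.apply_basis_ne_zero (coordBasis hφ hy) (μ.ne_zero _)
    have key := congrArg (fun ω' => ω' (coordBasis hφ hy)) (bivector_smul_toForm μ Ω f k (φ.symm y)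
      (mvfderiv (𝓡 (m + 2)) g (φ.symm y)) (mvfderiv (𝓡 (m + 2)) h (φ.symm y)))
    simp only [AlternatingMap.smul_apply, smul_eq_mul,
      wedgePullback_coordBasis Ω f hφ hψ hy hfy hgy hhy] at key
    rw [← eq_div_iff hμy] at key
    rw [funext (coordBasis_apply hφ hy)] at key
    exact key

end Bivector

/-! ### Adapted charts at regular points -/

section Splitting

/-- A splitting of the model space of the source into a plane and the model space of the target. -/
noncomputable def splitting (m : ℕ) :
    EuclideanSpace ℝ (Fin (m + 2)) ≃L[ℝ] (ℝ × ℝ) × EuclideanSpace ℝ (Fin m) :=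
  ContinuousLinearEquiv.ofFinrankEq (by simp; omega)

/-- The first coordinate of the plane. -/
noncomputable def planeFst (m : ℕ) : EuclideanSpace ℝ (Fin (m + 2)) →L[ℝ] ℝ :=
  ContinuousLinearMap.fst ℝ ℝ ℝ ∘L ContinuousLinearMap.fst ℝ _ _ ∘L
    (splitting m).toContinuousLinearMap

/-- The second coordinate of the plane. -/
noncomputable def planeSnd (m : ℕ) : EuclideanSpace ℝ (Fin (m + 2)) →L[ℝ] ℝ :=
  ContinuousLinearMap.snd ℝ ℝ ℝ ∘L ContinuousLinearMap.fst ℝ _ _ ∘L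
    (splitting m).toContinuousLinearMap

/-- The projection along the plane. -/
noncomputable def baseProj (m : ℕ) :
    EuclideanSpace ℝ (Fin (m + 2)) →L[ℝ] EuclideanSpace ℝ (Fin m) :=
  ContinuousLinearMap.snd ℝ _ _ ∘L (splitting m).toContinuousLinearMap

/-- The first basis vector of the plane. -/
noncomputable def vecFst (m : ℕ) : EuclideanSpace ℝ (Fin (m + 2)) := (splitting m).symm ((1, 0), 0)

/-- The second basis vector of the plane. -/
noncomputable def vecSnd (m : ℕ) : EuclideanSpace ℝ (Fin (m + 2)) := (splitting m).symm ((0, 1), 0)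

variable {m : ℕ}

@[simp] lemma planeFst_vecFst : planeFst m (vecFst m) = 1 := by simp [planeFst, vecFst]
@[simp] lemma planeFst_vecSnd : planeFst m (vecSnd m) = 0 := by simp [planeFst, vecSnd]
@[simp] lemma planeSnd_vecFst : planeSnd m (vecFst m) = 0 := by simp [planeSnd, vecFst]
@[simp] lemma planeSnd_vecSnd : planeSnd m (vecSnd m) = 1 := by simp [planeSnd, vecSnd]
@[simp] lemma baseProj_vecFst : baseProj m (vecFst m) = 0 := by simp [baseProj, vecFst]
@[simp] lemma baseProj_vecSnd : baseProj m (vecSnd m) = 0 := by simp [baseProj, vecSnd]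

lemma baseProj_surjective : Function.Surjective (baseProj m) := fun w =>
  ⟨(splitting m).symm (0, w), by simp [baseProj]⟩

lemma splitting_decomp (v : EuclideanSpace ℝ (Fin (m + 2))) :
    v = planeFst m v • vecFst m + planeSnd m v • vecSnd m +
      (splitting m).symm (0, baseProj m v) := by
  apply (splitting m).injective
  simp [planeFst, planeSnd, baseProj, vecFst, vecSnd]

lemma finrank_ker_baseProj : Module.finrank ℝ (LinearMap.ker (baseProj m).toLinearMap) = 2 := by
  have h := LinearMap.finrank_range_add_finrank_ker (baseProj m).toLinearMap
  rw [LinearMap.range_eq_top.2 baseProj_surjective] at h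
  simp at h
  omega

/-- The last summand factors through `baseProj`; in an adapted chart it becomes a covector pulled
back by `df`, which the bivector ignores. -/
lemma covector_decomp (α : EuclideanSpace ℝ (Fin (m + 2)) →L[ℝ] ℝ) :
    α = α (vecFst m) • planeFst m + α (vecSnd m) • planeSnd m +
      (α ∘L (splitting m).symm.toContinuousLinearMap ∘L ContinuousLinearMap.inr ℝ _ _) ∘L
        baseProj m := by
  ext v
  conv_lhs => rw [splitting_decomp v]
  simp [mul_comm]

end Splitting

/-! ### Linear complements and the inverse function theorem -/

section NormalForm

/-- `B` is a projection onto the two-dimensional kernel of `A`, read in a plane; injectivity plus a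
dimension count suffices. -/
lemma exists_prod_bijective {m : ℕ}
    {A : EuclideanSpace ℝ (Fin (m + 2)) →L[ℝ] EuclideanSpace ℝ (Fin m)}
    (hA : Function.Surjective A) :
    ∃ B : EuclideanSpace ℝ (Fin (m + 2)) →L[ℝ] ℝ × ℝ, Function.Bijective (B.prod A) := by
  have hker : Module.finrank ℝ (LinearMap.ker A.toLinearMap) = Module.finrank ℝ (ℝ × ℝ) := by
    have h := LinearMap.finrank_range_add_finrank_ker A.toLinearMap
    rw [LinearMap.range_eq_top.2 hA] at h
    simp at h ⊢
    omega
  obtain ⟨P, hP⟩ := LinearMap.exists_leftInverse_of_injective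
    (LinearMap.ker A.toLinearMap).subtype (Submodule.ker_subtype _)
  let κ := LinearEquiv.ofFinrankEq _ _ hker
  let B : EuclideanSpace ℝ (Fin (m + 2)) →L[ℝ] ℝ × ℝ :=
    LinearMap.toContinuousLinearMap (κ.toLinearMap ∘ₗ P)
  have hinj : Function.Injective (B.prod A).toLinearMap := by
    rw [← LinearMap.ker_eq_bot, LinearMap.ker_eq_bot']
    intro v hv
    have h1 : κ (P v) = 0 := (Prod.ext_iff.1 hv).1
    have h2 : A v = 0 := (Prod.ext_iff.1 hv).2
    have h3 := LinearMap.congr_fun hP ⟨v, h2⟩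
    have h4 : P v = ⟨v, h2⟩ := h3
    rw [LinearEquiv.map_eq_zero_iff] at h1
    rw [h1] at h4
    exact (congrArg Subtype.val h4).symm
  refine ⟨B, hinj, ?_⟩
  exact (LinearMap.injective_iff_surjective_of_finrank_eq_finrank
    (by simp; omega)).1 hinj

/-- A local diffeomorphism of a vector space around a point restricts to an open partial
homeomorphism that is smooth with smooth inverse. -/
lemma ContDiffOn.exists_openPartialHomeomorph {E : Type*} [NormedAddCommGroup E] [NormedSpace ℝ E]
    [CompleteSpace E] {Φ : E → E} {U : Set E} (hU : IsOpen U) (hΦ : ContDiffOn ℝ ∞ Φ U) {a : E}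
    (ha : a ∈ U) (A : E ≃L[ℝ] E) (hA : HasFDerivAt Φ (A : E →L[ℝ] E) a) :
    ∃ R : OpenPartialHomeomorph E E, (R : E → E) = Φ ∧ a ∈ R.source ∧ R.source ⊆ U ∧
      ContDiffOn ℝ ∞ R.symm R.target := by
  have hΦa : ContDiffAt ℝ ∞ Φ a := hΦ.contDiffAt (hU.mem_nhds ha)
  let R₀ := hΦa.toOpenPartialHomeomorph Φ hA (by simp)
  have hcont : ContinuousOn (fderiv ℝ Φ) U := hΦ.continuousOn_fderiv_of_isOpen hU (by simp)
  -- The inverse function theorem gives smoothness of the inverse only at the image of `a`.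
  -- Restricting to the open set where the derivative is invertible gives it on the whole target.
  have hopen : IsOpen (U ∩ fderiv ℝ Φ ⁻¹' Set.range ((↑) : (E ≃L[ℝ] E) → E →L[ℝ] E)) :=
    hcont.isOpen_inter_preimage hU ContinuousLinearEquiv.isOpen
  refine ⟨R₀.restrOpen _ hopen, rfl, ⟨hΦa.mem_toOpenPartialHomeomorph_source hA (by simp), ha, A,
    hA.fderiv.symm⟩, fun x hx => hx.2.1, fun z hz => ?_⟩
  have hz' := (R₀.restrOpen _ hopen).map_target hz
  obtain ⟨-, hzU, A', hA'⟩ := hz'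
  have hd : ContDiffAt ℝ ∞ Φ ((R₀.restrOpen _ hopen).symm z) := hΦ.contDiffAt (hU.mem_nhds hzU)
  refine ((R₀.restrOpen _ hopen).contDiffAt_symm hz (f₀' := A') ?_ hd).contDiffWithinAt
  rw [hA']
  exact (hd.differentiableAt (by simp)).hasFDerivAt

end NormalForm

section AdaptedChart

variable {m : ℕ} {M : Type*} [TopologicalSpace M]
  [ChartedSpace (EuclideanSpace ℝ (Fin (m + 2))) M]
  {N : Type*} [TopologicalSpace N] [ChartedSpace (EuclideanSpace ℝ (Fin m)) N]

/-- A pair of charts in which `f` is a linear projection. -/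
structure IsAdaptedChart (f : C^∞⟮𝓡 (m + 2), M; 𝓡 m, N⟯)
    (φ : OpenPartialHomeomorph M (EuclideanSpace ℝ (Fin (m + 2))))
    (ψ : OpenPartialHomeomorph N (EuclideanSpace ℝ (Fin m))) : Prop where
  mem_atlas : φ ∈ IsManifold.maximalAtlas (𝓡 (m + 2)) ∞ M
  mem_atlas_base : ψ ∈ IsManifold.maximalAtlas (𝓡 m) ∞ N
  convex : Convex ℝ φ.target
  mem_source : ∀ x ∈ φ.source, f x ∈ ψ.source
  apply_eq : ∀ x ∈ φ.source, ψ (f x) = baseProj m (φ x)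

variable [IsManifold (𝓡 (m + 2)) ∞ M] [IsManifold (𝓡 m) ∞ N]

/-- Submersion normal form: the local expression of `f` is completed by two linear functions to a
local diffeomorphism. -/
lemma exists_isAdaptedChart {f : C^∞⟮𝓡 (m + 2), M; 𝓡 m, N⟯} {p : M} (hp : p ∉ criticalSet f) :
    ∃ φ ψ, IsAdaptedChart f φ ψ ∧ p ∈ φ.source := by
  set φ₀ := chartAt (EuclideanSpace ℝ (Fin (m + 2))) p
  set ψ := chartAt (EuclideanSpace ℝ (Fin m)) (f p)
  have hφ₀ : φ₀ ∈ IsManifold.maximalAtlas (𝓡 (m + 2)) ∞ M := IsManifold.chart_mem_maximalAtlas p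
  have hψ : ψ ∈ IsManifold.maximalAtlas (𝓡 m) ∞ N := IsManifold.chart_mem_maximalAtlas (f p)
  have hp₀ : p ∈ φ₀.source := mem_chart_source _ p
  have hfp : f p ∈ ψ.source := mem_chart_source _ _
  set G := (ψ ∘ f) ∘ φ₀.symm
  set U := φ₀.target ∩ φ₀.symm ⁻¹' (f ⁻¹' ψ.source)
  have hU : IsOpen U :=
    φ₀.isOpen_inter_preimage_symm (ψ.open_source.preimage f.contMDiff.continuous)
  have hy₀ : φ₀ p ∈ U := ⟨φ₀.map_source hp₀, by simpa [φ₀.left_inv hp₀] using hfp⟩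
  have hψf : ∀ y ∈ U, ContMDiffAt (𝓡 (m + 2)) (𝓡 m) ∞ (ψ ∘ f) (φ₀.symm y) := fun y hy =>
    (contMDiffAt_of_mem_maximalAtlas hψ hy.2).comp _ f.contMDiff.contMDiffAt
  have hG : ContDiffOn ℝ ∞ G U := fun y hy =>
    (contDiffAt_comp_chart_symm hφ₀ hy.1 (hψf y hy)).contDiffWithinAt
  have hGd : DifferentiableAt ℝ G (φ₀ p) :=
    (hG.contDiffAt (hU.mem_nhds hy₀)).differentiableAt (by simp)
  have hsurj : Function.Surjective (fderiv ℝ G (φ₀ p)) := by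
    intro w
    have hψd := (mdifferentiable_of_mem_maximalAtlas hψ)
    obtain ⟨u, hu⟩ := hψd.mfderiv_surjective hfp w
    obtain ⟨v, hv⟩ := not_not.1 hp u
    have h1 : MDifferentiableAt (𝓡 (m + 2)) (𝓡 m) (ψ ∘ f) p :=
      (hψd.mdifferentiableAt hfp).comp p (f.contMDiff.mdifferentiableAt (by simp))
    refine ⟨mvfderiv (𝓡 (m + 2)) φ₀ p v, ?_⟩
    rw [← mvfderiv_eq_fderiv_comp_mfderiv hφ₀ hp₀ h1]
    have h2 := mfderiv_comp p (hψd.mdifferentiableAt hfp)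
      (f.contMDiff.mdifferentiableAt (by simp) : MDifferentiableAt (𝓡 (m + 2)) (𝓡 m) f p)
    have h3 : mvfderiv (𝓡 (m + 2)) (ψ ∘ f) p v = mfderiv (𝓡 m) (𝓡 m) ψ (f p)
      (mfderiv (𝓡 (m + 2)) (𝓡 m) f p v) := DFunLike.congr_fun h2 v
    rw [h3, hv, hu]
  obtain ⟨B, hB⟩ := exists_prod_bijective hsurj
  let e : EuclideanSpace ℝ (Fin (m + 2)) ≃L[ℝ] (ℝ × ℝ) × EuclideanSpace ℝ (Fin m) :=
    (LinearEquiv.ofBijective (B.prod (fderiv ℝ G (φ₀ p))).toLinearMap hB).toContinuousLinearEquiv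
  let Φ : EuclideanSpace ℝ (Fin (m + 2)) → EuclideanSpace ℝ (Fin (m + 2)) := fun y =>
    (splitting m).symm (B y, G y)
  have hΦ : ContDiffOn ℝ ∞ Φ U :=
    (splitting m).symm.contDiff.comp_contDiffOn (B.contDiff.contDiffOn.prodMk hG)
  have hΦd : HasFDerivAt Φ ((e.trans (splitting m).symm : _ ≃L[ℝ] _) :
      EuclideanSpace ℝ (Fin (m + 2)) →L[ℝ] EuclideanSpace ℝ (Fin (m + 2))) (φ₀ p) :=
    (splitting m).symm.hasFDerivAt.comp (φ₀ p) (B.hasFDerivAt.prodMk hGd.hasFDerivAt)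
  obtain ⟨R, hRΦ, hpR, hRU, hRsymm⟩ := hΦ.exists_openPartialHomeomorph hU hy₀ _ hΦd
  set χ := φ₀.trans R
  have hpχ : p ∈ χ.source := by simp [χ, hp₀, hpR]
  -- Shrinking the image to a ball makes it convex, as needed for joining points by segments.
  obtain ⟨ε, hε, hball⟩ := Metric.isOpen_iff.1 χ.open_target _ (χ.map_source hpχ)
  let φ := (χ.symm.restrOpen _ (Metric.isOpen_ball (x := χ p) (ε := ε))).symm
  have hsource : ∀ x ∈ φ.source, x ∈ φ₀.source ∧ φ₀ x ∈ R.source := fun x hx => by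
    have h1 := φ.map_source hx
    have h2 : χ.symm (φ x) ∈ χ.source := χ.map_target h1.1
    have h3 : χ.symm (φ x) = x := φ.left_inv hx
    rw [h3] at h2
    simpa [χ] using h2
  have htarget : φ.target = Metric.ball (χ p) ε := by
    show χ.target ∩ Metric.ball (χ p) ε = _
    exact Set.inter_eq_right.2 hball
  have hφ : ∀ x, φ x = Φ (φ₀ x) := fun x => by
    show R (φ₀ x) = _
    rw [hRΦ]
  refine ⟨φ, ψ, ⟨φ.mem_maximalAtlas_of_contMDiffOn ?_ ?_, hψ, ?_, ?_, ?_⟩, ?_⟩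
  · intro x hx
    obtain ⟨h1, h2⟩ := hsource x hx
    have h3 : ContMDiffAt (𝓡 (m + 2)) (𝓡 (m + 2)) ∞ Φ (φ₀ x) :=
      contMDiffAt_iff_contDiffAt.2 (hΦ.contDiffAt (hU.mem_nhds (hRU h2)))
    have h4 : (φ : M → EuclideanSpace ℝ (Fin (m + 2))) = Φ ∘ φ₀ := funext hφ
    rw [h4]
    exact (h3.comp x (contMDiffAt_of_mem_maximalAtlas hφ₀ h1)).contMDiffWithinAt
  · intro z hz
    have hzχ : z ∈ χ.target := hz.1
    simp only [χ, OpenPartialHomeomorph.trans_target] at hzχ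
    have h3 : ContMDiffAt (𝓡 (m + 2)) (𝓡 (m + 2)) ∞ R.symm z :=
      contMDiffAt_iff_contDiffAt.2 (hRsymm.contDiffAt (R.open_target.mem_nhds hzχ.1))
    exact ((contMDiffAt_symm_of_mem_maximalAtlas hφ₀ hzχ.2).comp z h3).contMDiffWithinAt
  · rw [htarget]
    exact convex_ball _ _
  · intro x hx
    obtain ⟨h1, h2⟩ := hsource x hx
    simpa [φ₀.left_inv h1] using (hRU h2).2
  · intro x hx
    obtain ⟨h1, h2⟩ := hsource x hx
    rw [hφ]
    simp [Φ, baseProj, G, φ₀.left_inv h1]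
  · have h1 : χ p ∈ φ.target := by
      rw [htarget]
      exact Metric.mem_ball_self hε
    have h2 := φ.map_target h1
    have h3 : φ.symm (χ p) = p := χ.left_inv hpχ
    rwa [h3] at h2

end AdaptedChart

/-! ### The bivector in an adapted chart -/

section AdaptedCalculus

variable {m : ℕ} {M : Type*} [TopologicalSpace M]
  [ChartedSpace (EuclideanSpace ℝ (Fin (m + 2))) M]
  {N : Type*} [TopologicalSpace N] [ChartedSpace (EuclideanSpace ℝ (Fin m)) N]
  {f : C^∞⟮𝓡 (m + 2), M; 𝓡 m, N⟯}
  {φ : OpenPartialHomeomorph M (EuclideanSpace ℝ (Fin (m + 2)))}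
  {ψ : OpenPartialHomeomorph N (EuclideanSpace ℝ (Fin m))}

namespace IsAdaptedChart

/-- The derivative of the identity `ψ ∘ f = baseProj m ∘ φ`, valid near `x`. -/
lemma baseProj_comp (hc : IsAdaptedChart f φ ψ) {x : M} (hx : x ∈ φ.source)
    (v : TangentSpace (𝓡 (m + 2)) x) :
    baseProj m (mvfderiv (𝓡 (m + 2)) φ x v) =
      mvfderiv (𝓡 m) ψ (f x) (mfderiv (𝓡 (m + 2)) (𝓡 m) f x v) := by
  have hψd := (mdifferentiable_of_mem_maximalAtlas hc.mem_atlas_base).mdifferentiableAt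
    (hc.mem_source x hx)
  have hφd := (mdifferentiable_of_mem_maximalAtlas hc.mem_atlas).mdifferentiableAt hx
  have hfd : MDifferentiableAt (𝓡 (m + 2)) (𝓡 m) f x := f.contMDiff.mdifferentiableAt (by simp)
  have h1 := mfderiv_comp x hψd hfd
  have h2 := mfderiv_comp x
    ((baseProj m).differentiableAt (x := φ x)).mdifferentiableAt hφd
  have h3 : (ψ ∘ f) =ᶠ[nhds x] (baseProj m ∘ φ) := by
    filter_upwards [φ.open_source.mem_nhds hx] with z hz using hc.apply_eq z hz
  have h4 := h3.mfderiv_eq (I := 𝓡 (m + 2)) (I' := 𝓡 m)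
  rw [mfderiv_eq_fderiv, ContinuousLinearMap.fderiv] at h2
  have h5 := DFunLike.congr_fun h1 v
  have h6 := DFunLike.congr_fun h2 v
  have h7 := DFunLike.congr_fun h4 v
  exact h6.symm.trans (h7.symm.trans h5)

lemma notMem_criticalSet (hc : IsAdaptedChart f φ ψ) {x : M} (hx : x ∈ φ.source) :
    x ∉ criticalSet f := by
  refine not_not.2 fun w => ?_
  have hφ := mdifferentiable_of_mem_maximalAtlas hc.mem_atlas
  have hψ := mdifferentiable_of_mem_maximalAtlas hc.mem_atlas_base
  obtain ⟨u, hu⟩ := baseProj_surjective (m := m) (mvfderiv (𝓡 m) ψ (f x) w)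
  obtain ⟨v, hv⟩ := hφ.mfderiv_surjective hx u
  refine ⟨v, hψ.mfderiv_injective (hc.mem_source x hx) ?_⟩
  have h := hc.baseProj_comp hx v
  have hv' : mvfderiv (𝓡 (m + 2)) φ x v = u := hv
  rw [hv', hu] at h
  exact h.symm

lemma mfderiv_eq_zero_iff (hc : IsAdaptedChart f φ ψ) {x : M} (hx : x ∈ φ.source)
    (v : TangentSpace (𝓡 (m + 2)) x) :
    mfderiv (𝓡 (m + 2)) (𝓡 m) f x v = 0 ↔ baseProj m (mvfderiv (𝓡 (m + 2)) φ x v) = 0 := by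
  rw [hc.baseProj_comp hx v]
  refine ⟨fun h => by rw [h, map_zero], fun h => ?_⟩
  refine (mdifferentiable_of_mem_maximalAtlas hc.mem_atlas_base).mfderiv_injective
    (hc.mem_source x hx) ?_
  have h' : mfderiv (𝓡 m) (𝓡 m) ψ (f x) (mfderiv (𝓡 (m + 2)) (𝓡 m) f x v) = 0 := h
  rw [h', map_zero]

end IsAdaptedChart

variable (μ : VolumeForm (m + 2) M) (Ω : VolumeForm m N) (k : C^∞⟮𝓡 (m + 2), M; ℝ⟯)

variable (f φ) in
/-- The coefficient of the bivector in an adapted chart. -/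
noncomputable def planeCoeff (x : M) : ℝ :=
  bivector μ Ω f k x (mvfderiv (𝓡 (m + 2)) (planeFst m ∘ φ) x)
    (mvfderiv (𝓡 (m + 2)) (planeSnd m ∘ φ) x)

namespace IsAdaptedChart

/-- Modulo covectors pulled back by `df`, every covector is a combination of the two plane
coordinates. Antisymmetry then leaves a 2 × 2 minor times one coefficient. -/
lemma bivector_comp (hc : IsAdaptedChart f φ ψ) {x : M} (hx : x ∈ φ.source)
    (α β : EuclideanSpace ℝ (Fin (m + 2)) →L[ℝ] ℝ) :
    bivector μ Ω f k x (α ∘L mvfderiv (𝓡 (m + 2)) φ x) (β ∘L mvfderiv (𝓡 (m + 2)) φ x) =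
      (α (vecFst m) * β (vecSnd m) - α (vecSnd m) * β (vecFst m)) * planeCoeff f φ μ Ω k x := by
  have hdec : ∀ α : EuclideanSpace ℝ (Fin (m + 2)) →L[ℝ] ℝ,
      ∃ γ : TangentSpace (𝓡 m) (f x) →L[ℝ] ℝ, α ∘L mvfderiv (𝓡 (m + 2)) φ x =
        α (vecFst m) • mvfderiv (𝓡 (m + 2)) (planeFst m ∘ φ) x +
        α (vecSnd m) • mvfderiv (𝓡 (m + 2)) (planeSnd m ∘ φ) x +
        γ ∘L mfderiv (𝓡 (m + 2)) (𝓡 m) f x := fun α => by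
    refine ⟨(α ∘L (splitting m).symm.toContinuousLinearMap ∘L ContinuousLinearMap.inr ℝ _ _) ∘L
      mvfderiv (𝓡 m) ψ (f x), ?_⟩
    rw [mvfderiv_clm_comp_chart hc.mem_atlas hx, mvfderiv_clm_comp_chart hc.mem_atlas hx]
    ext v
    have h := DFunLike.congr_fun (covector_decomp α) (mvfderiv (𝓡 (m + 2)) φ x v)
    rw [add_apply, ContinuousLinearMap.comp_apply (g := _ ∘L _),
      hc.baseProj_comp hx v] at h
    exact h
  obtain ⟨γ, hγ⟩ := hdec α
  obtain ⟨δ, hδ⟩ := hdec β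
  rw [hγ, hδ]
  simp only [map_add, map_smul, LinearMap.add_apply, LinearMap.smul_apply, smul_eq_mul,
    bivector_comp_mfderiv_left, bivector_comp_mfderiv_right, bivector_self]
  rw [bivector_swap μ Ω f k x (mvfderiv (𝓡 (m + 2)) (planeSnd m ∘ φ) x)
    (mvfderiv (𝓡 (m + 2)) (planeFst m ∘ φ) x)]
  simp only [planeCoeff]
  ring

/-- The chart vectors over `vecFst` and `vecSnd` lie in `ker df` and are dual to the two plane
coordinates, so `bivector_ne_zero` applies. -/
lemma planeCoeff_ne_zero (hc : IsAdaptedChart f φ ψ) {x : M} (hx : x ∈ φ.source) (hk : k x ≠ 0) :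
    planeCoeff f φ μ Ω k x ≠ 0 := by
  have hφ := mdifferentiable_of_mem_maximalAtlas hc.mem_atlas
  obtain ⟨v, hv⟩ := hφ.mfderiv_surjective hx (vecFst m)
  obtain ⟨w, hw⟩ := hφ.mfderiv_surjective hx (vecSnd m)
  have hv' : mvfderiv (𝓡 (m + 2)) φ x v = vecFst m := hv
  have hw' : mvfderiv (𝓡 (m + 2)) φ x w = vecSnd m := hw
  rw [planeCoeff, mvfderiv_clm_comp_chart hc.mem_atlas hx, mvfderiv_clm_comp_chart hc.mem_atlas hx]
  refine bivector_ne_zero μ Ω f k hk (hc.notMem_criticalSet hx) (v := v) (w := w) ?_ ?_ ?_ ?_ ?_ ?_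
  · rw [hc.mfderiv_eq_zero_iff hx, hv', baseProj_vecFst]
  · rw [hc.mfderiv_eq_zero_iff hx, hw', baseProj_vecSnd]
  all_goals simp [hv', hw']

lemma contMDiffAt_planeCoeff [IsManifold (𝓡 (m + 2)) ∞ M] [IsManifold (𝓡 m) ∞ N] (hc : IsAdaptedChart f φ ψ) {x : M}
    (hx : x ∈ φ.source) :
    ContMDiffAt (𝓡 (m + 2)) 𝓘(ℝ, ℝ) ∞ (planeCoeff f φ μ Ω k) x :=
  contMDiffAt_bivector μ Ω f k
    ((planeFst m).contDiff.contMDiff.contMDiffAt.comp x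
      (contMDiffAt_of_mem_maximalAtlas hc.mem_atlas hx))
    ((planeSnd m).contDiff.contMDiff.contMDiffAt.comp x
      (contMDiffAt_of_mem_maximalAtlas hc.mem_atlas hx))

/-- The bracket in an adapted chart. -/
lemma bivector_mvfderiv (hc : IsAdaptedChart f φ ψ) {y : EuclideanSpace ℝ (Fin (m + 2))}
    (hy : y ∈ φ.target) {g h : M → ℝ} (hg : MDifferentiableAt (𝓡 (m + 2)) 𝓘(ℝ, ℝ) g (φ.symm y))
    (hh : MDifferentiableAt (𝓡 (m + 2)) 𝓘(ℝ, ℝ) h (φ.symm y)) :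
    bivector μ Ω f k (φ.symm y) (mvfderiv (𝓡 (m + 2)) g (φ.symm y))
        (mvfderiv (𝓡 (m + 2)) h (φ.symm y)) =
      (fderiv ℝ (g ∘ φ.symm) y (vecFst m) * fderiv ℝ (h ∘ φ.symm) y (vecSnd m) -
        fderiv ℝ (g ∘ φ.symm) y (vecSnd m) * fderiv ℝ (h ∘ φ.symm) y (vecFst m)) *
        (planeCoeff f φ μ Ω k ∘ φ.symm) y := by
  have hx := φ.map_target hy
  have h1 : ∀ {g : M → ℝ}, MDifferentiableAt (𝓡 (m + 2)) 𝓘(ℝ, ℝ) g (φ.symm y) →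
      mvfderiv (𝓡 (m + 2)) g (φ.symm y) =
        fderiv ℝ (g ∘ φ.symm) y ∘L mvfderiv (𝓡 (m + 2)) φ (φ.symm y) := fun hg => by
    ext v
    rw [mvfderiv_eq_fderiv_comp_mfderiv hc.mem_atlas hx hg, φ.right_inv hy]
    rfl
  rw [h1 hg, h1 hh, hc.bivector_comp μ Ω k hx]
  rfl

end IsAdaptedChart

end AdaptedCalculus

/-! ### The Jacobi identity for two directions -/

section Jacobi

variable {E : Type*} [NormedAddCommGroup E] [NormedSpace ℝ E]

/-- The Jacobi identity for a bracket `(G, H) ↦ c (∂_u G ∂_v H - ∂_v G ∂_u H)`. -/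
lemma jacobi_of_plane {c G H L : E → ℝ} {y u v : E} (hc : ContDiffAt ℝ ∞ c y)
    (hG : ContDiffAt ℝ ∞ G y) (hH : ContDiffAt ℝ ∞ H y) (hL : ContDiffAt ℝ ∞ L y)
    (br : (E → ℝ) → (E → ℝ) → E → ℝ)
    (hbr : ∀ G H z, br G H z = (fderiv ℝ G z u * fderiv ℝ H z v -
      fderiv ℝ G z v * fderiv ℝ H z u) * c z) :
    br G (br H L) y + br H (br L G) y + br L (br G H) y = 0 := by
  have hd : ∀ {G : E → ℝ} (w : E), ContDiffAt ℝ ∞ G y →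
      HasFDerivAt (fun z => fderiv ℝ G z w) ((fderiv ℝ (fderiv ℝ G) y).flip w) y := by
    intro G w hG
    have h1 : DifferentiableAt ℝ (fderiv ℝ G) y :=
      (hG.fderiv_right (m := ∞) (by simp)).differentiableAt (by simp)
    exact (h1.hasFDerivAt.clm_apply (hasFDerivAt_const w y)).congr_fderiv (by ext; simp)
  have hsymm : ∀ {G : E → ℝ}, ContDiffAt ℝ ∞ G y →
      fderiv ℝ (fderiv ℝ G) y u v = fderiv ℝ (fderiv ℝ G) y v u := fun hG =>
    (hG.isSymmSndFDerivAt (by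
      rw [minSmoothness_of_isRCLikeNormedField]
      exact WithTop.coe_le_coe.2 (le_top : (2 : ℕ∞) ≤ ⊤))).eq u v
  have hc' : HasFDerivAt c (fderiv ℝ c y) y := (hc.differentiableAt (by simp)).hasFDerivAt
  have hbrd : ∀ {G H : E → ℝ} (w : E), ContDiffAt ℝ ∞ G y → ContDiffAt ℝ ∞ H y →
      fderiv ℝ (br G H) y w =
        (fderiv ℝ G y u * fderiv ℝ H y v - fderiv ℝ G y v * fderiv ℝ H y u) * fderiv ℝ c y w +
        c y * (fderiv ℝ G y u * fderiv ℝ (fderiv ℝ H) y w v +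
          fderiv ℝ H y v * fderiv ℝ (fderiv ℝ G) y w u -
          (fderiv ℝ G y v * fderiv ℝ (fderiv ℝ H) y w u +
            fderiv ℝ H y u * fderiv ℝ (fderiv ℝ G) y w v)) := by
    intro G H w hG hH
    have h := (((hd u hG).mul (hd v hH)).sub ((hd v hG).mul (hd u hH))).mul hc'
    rw [(h.congr_of_eventuallyEq (.of_forall (hbr G H))).fderiv]
    simp
  rw [hbr G, hbr H (br L G), hbr L (br G H)]
  simp only [hbrd _ hG hH, hbrd _ hH hL, hbrd _ hL hG]
  -- With symmetric second derivatives the second-order terms cancel. The terms in the derivative of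
  -- `c` cancel as 3 × 3 determinants with a repeated row, since only `u` and `v` occur.
  rw [hsymm hG, hsymm hH, hsymm hL]
  ring

end Jacobi

/-! ### Covectors as differentials, vectors as functionals on covectors -/

section Covectors

variable {n : ℕ} {M : Type*} [TopologicalSpace M] [ChartedSpace (EuclideanSpace ℝ (Fin n)) M]

lemma exists_covector_comp_chart {φ : OpenPartialHomeomorph M (EuclideanSpace ℝ (Fin n))}
    (hφ : φ ∈ IsManifold.maximalAtlas (𝓡 n) ∞ M) {x : M} (hx : x ∈ φ.source)
    (α : TangentSpace (𝓡 n) x →L[ℝ] ℝ) :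
    ∃ α' : EuclideanSpace ℝ (Fin n) →L[ℝ] ℝ, α = α' ∘L mvfderiv (𝓡 n) φ x := by
  refine ⟨α ∘L mfderiv (𝓡 n) (𝓡 n) φ.symm (φ x), ?_⟩
  ext v
  exact congrArg α
    (DFunLike.congr_fun ((mdifferentiable_of_mem_maximalAtlas hφ).symm_comp_deriv hx) v).symm

/-- Every covector at a point is the differential of a global smooth function. -/
lemma exists_mvfderiv_eq [T2Space M] [IsManifold (𝓡 n) ∞ M] {x : M}
    (α : TangentSpace (𝓡 n) x →L[ℝ] ℝ) : ∃ h : C^∞⟮𝓡 n, M; ℝ⟯, mvfderiv (𝓡 n) h x = α := by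
  set φ := chartAt (EuclideanSpace ℝ (Fin n)) x
  have hφ : φ ∈ IsManifold.maximalAtlas (𝓡 n) ∞ M := IsManifold.chart_mem_maximalAtlas x
  have hx : x ∈ φ.source := mem_chart_source _ x
  obtain ⟨α', rfl⟩ := exists_covector_comp_chart hφ hx α
  obtain ⟨χ⟩ : Nonempty (SmoothBumpFunction (𝓡 n) x) := inferInstance
  have hs : ContMDiff (𝓡 n) 𝓘(ℝ, ℝ) ∞ fun z => χ z • (α' ∘ φ) z :=
    χ.contMDiff_smul (α'.contDiff.contMDiff.comp_contMDiffOn (contMDiffOn_of_mem_maximalAtlas hφ))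
  refine ⟨⟨_, hs⟩, Eq.trans ?_ (mvfderiv_clm_comp_chart hφ hx α')⟩
  have he : (fun z => χ z • (α' ∘ φ) z) =ᶠ[nhds x] (α' ∘ φ) := by
    filter_upwards [χ.eventuallyEq_one] with z hz
    simp [hz]
  have h := he.mfderiv_eq (I := 𝓡 n) (I' := 𝓘(ℝ, ℝ))
  ext v
  exact DFunLike.congr_fun h v

lemma eq_of_covector_apply_eq {x : M} {v w : TangentSpace (𝓡 n) x}
    (h : ∀ β : TangentSpace (𝓡 n) x →L[ℝ] ℝ, β v = β w) : v = w :=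
  PiLp.ext fun i => h (EuclideanSpace.proj i : EuclideanSpace ℝ (Fin n) →L[ℝ] ℝ)

/-- A tangent vector is determined by a linear form on covectors. -/
lemma exists_covector_apply_eq {x : M} (F : (TangentSpace (𝓡 n) x →L[ℝ] ℝ) →ₗ[ℝ] ℝ) :
    ∃ v : TangentSpace (𝓡 n) x, ∀ β : TangentSpace (𝓡 n) x →L[ℝ] ℝ, β v = F β := by
  let pr : Fin n → (TangentSpace (𝓡 n) x →L[ℝ] ℝ) := fun i =>
    (EuclideanSpace.proj i : EuclideanSpace ℝ (Fin n) →L[ℝ] ℝ)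
  refine ⟨∑ i, F (pr i) • tangentBasis n x i, fun β => ?_⟩
  have hβ : β = ∑ i, β (tangentBasis n x i) • pr i := by
    ext v
    conv_lhs => rw [← (tangentBasis n x).sum_repr v]
    rw [map_sum, sum_apply]
    refine Finset.sum_congr rfl fun i _ => ?_
    rw [map_smul, smul_eq_mul, mul_comm]
    rfl
  conv_rhs => rw [hβ]
  simp [map_sum, map_smul, mul_comm]

end Covectors

namespace ContMDiffMap

variable {n : ℕ} {M : Type*} [TopologicalSpace M] [ChartedSpace (EuclideanSpace ℝ (Fin n)) M]

lemma mdifferentiableAt_real (g : C^∞⟮𝓡 n, M; ℝ⟯) (x : M) :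
    MDifferentiableAt (𝓡 n) 𝓘(ℝ, ℝ) g x := g.contMDiff.mdifferentiableAt (by simp)

lemma mvfderiv_coe_add (g h : C^∞⟮𝓡 n, M; ℝ⟯) (x : M) :
    mvfderiv (𝓡 n) (⇑g + ⇑h) x = mvfderiv (𝓡 n) g x + mvfderiv (𝓡 n) h x :=
  mvfderiv_add (g.mdifferentiableAt_real x) (h.mdifferentiableAt_real x)

lemma mvfderiv_coe_mul (g h : C^∞⟮𝓡 n, M; ℝ⟯) (x : M) :
    mvfderiv (𝓡 n) (⇑g * ⇑h) x = g x • mvfderiv (𝓡 n) h x + h x • mvfderiv (𝓡 n) g x :=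
  mvfderiv_mul (g.mdifferentiableAt_real x) (h.mdifferentiableAt_real x)

lemma mvfderiv_coe_smul (c : ℝ) (g : C^∞⟮𝓡 n, M; ℝ⟯) (x : M) :
    mvfderiv (𝓡 n) (c • ⇑g) x = c • mvfderiv (𝓡 n) g x := by
  have h := mvfderiv_smul (I := 𝓡 n) (a := fun _ : M => c) (x := x)
    mdifferentiableAt_const (g.mdifferentiableAt_real x)
  rw [mvfderiv_const] at h
  exact h.trans (by ext; simp)

end ContMDiffMap

/-! ### The Poisson structure and its Hamiltonian vectors -/

section Poisson

variable {m : ℕ} {M : Type*} [TopologicalSpace M]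
  [ChartedSpace (EuclideanSpace ℝ (Fin (m + 2))) M]
  {N : Type*} [TopologicalSpace N] [ChartedSpace (EuclideanSpace ℝ (Fin m)) N]
  [IsManifold (𝓡 (m + 2)) ∞ M] [IsManifold (𝓡 m) ∞ N]
  (μ : VolumeForm (m + 2) M) (Ω : VolumeForm m N)
  (f : C^∞⟮𝓡 (m + 2), M; 𝓡 m, N⟯) (k : C^∞⟮𝓡 (m + 2), M; ℝ⟯)

/-- The function `{g, h}` with `{g, h} μ = k dg ∧ dh ∧ f^*Ω`. -/
noncomputable def jacobianBracket (g h : C^∞⟮𝓡 (m + 2), M; ℝ⟯) : C^∞⟮𝓡 (m + 2), M; ℝ⟯ :=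
  ⟨fun x => bivector μ Ω f k x (mvfderiv (𝓡 (m + 2)) g x) (mvfderiv (𝓡 (m + 2)) h x),
    fun _ => contMDiffAt_bivector μ Ω f k g.contMDiff.contMDiffAt h.contMDiff.contMDiffAt⟩

lemma jacobianBracket_apply (g h : C^∞⟮𝓡 (m + 2), M; ℝ⟯) (x : M) :
    jacobianBracket μ Ω f k g h x =
      bivector μ Ω f k x (mvfderiv (𝓡 (m + 2)) g x) (mvfderiv (𝓡 (m + 2)) h x) := rfl

lemma satisfiesFormula_iff (br : C^∞⟮𝓡 (m + 2), M; ℝ⟯ → C^∞⟮𝓡 (m + 2), M; ℝ⟯ →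
    C^∞⟮𝓡 (m + 2), M; ℝ⟯) :
    SatisfiesFormula μ Ω f k br ↔ br = jacobianBracket μ Ω f k := by
  refine ⟨fun H => ?_, ?_⟩
  · ext g h x
    exact smul_left_injective ℝ (μ.ne_zero x)
      ((H g h x).trans (bivector_smul_toForm μ Ω f k x _ _).symm)
  · rintro rfl g h x
    exact bivector_smul_toForm μ Ω f k x _ _

/-- At a critical point each outer bracket vanishes whatever its arguments. At a regular point an
adapted chart reduces the claim to `jacobi_of_plane`. -/
lemma jacobianBracket_jacobi (g h l : C^∞⟮𝓡 (m + 2), M; ℝ⟯) :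
    jacobianBracket μ Ω f k g (jacobianBracket μ Ω f k h l) +
      jacobianBracket μ Ω f k h (jacobianBracket μ Ω f k l g) +
      jacobianBracket μ Ω f k l (jacobianBracket μ Ω f k g h) = 0 := by
  ext x
  by_cases hx : x ∈ criticalSet f
  · simp [jacobianBracket_apply, bivector_eq_zero_of_mem_criticalSet μ Ω f k hx]
  obtain ⟨φ, ψ, hc, hxφ⟩ := exists_isAdaptedChart hx
  obtain ⟨y, hy, rfl⟩ : ∃ y ∈ φ.target, φ.symm y = x :=
    ⟨φ x, φ.map_source hxφ, φ.left_inv hxφ⟩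
  let C := planeCoeff f φ μ Ω k ∘ φ.symm
  let br : (EuclideanSpace ℝ (Fin (m + 2)) → ℝ) → (EuclideanSpace ℝ (Fin (m + 2)) → ℝ) →
      EuclideanSpace ℝ (Fin (m + 2)) → ℝ := fun G H z =>
    (fderiv ℝ G z (vecFst m) * fderiv ℝ H z (vecSnd m) -
      fderiv ℝ G z (vecSnd m) * fderiv ℝ H z (vecFst m)) * C z
  have hbr : ∀ (g h : C^∞⟮𝓡 (m + 2), M; ℝ⟯), ∀ z ∈ φ.target,
      jacobianBracket μ Ω f k g h (φ.symm z) = br (g ∘ φ.symm) (h ∘ φ.symm) z := fun g h z hz =>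
    hc.bivector_mvfderiv μ Ω k hz (g.mdifferentiableAt_real _) (h.mdifferentiableAt_real _)
  have hbr2 : ∀ (g h l : C^∞⟮𝓡 (m + 2), M; ℝ⟯),
      jacobianBracket μ Ω f k g (jacobianBracket μ Ω f k h l) (φ.symm y) =
        br (g ∘ φ.symm) (br (h ∘ φ.symm) (l ∘ φ.symm)) y := fun g h l => by
    -- The outer bracket differentiates the inner one, so their agreement is needed on a
    -- neighbourhood of `y`.
    have he : jacobianBracket μ Ω f k h l ∘ φ.symm =ᶠ[nhds y]
        br (h ∘ φ.symm) (l ∘ φ.symm) := by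
      filter_upwards [φ.open_target.mem_nhds hy] with z hz using hbr h l z hz
    rw [hbr g _ y hy]
    simp only [br]
    rw [he.fderiv_eq]
  have hs : ∀ g : C^∞⟮𝓡 (m + 2), M; ℝ⟯, ContDiffAt ℝ ∞ (g ∘ φ.symm) y := fun g =>
    contDiffAt_comp_chart_symm hc.mem_atlas hy g.contMDiff.contMDiffAt
  have hC : ContDiffAt ℝ ∞ C y :=
    contDiffAt_comp_chart_symm hc.mem_atlas hy (hc.contMDiffAt_planeCoeff μ Ω k hxφ)
  have hj := jacobi_of_plane hC (hs g) (hs h) (hs l) br fun _ _ _ => rfl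
  rw [← hbr2, ← hbr2, ← hbr2] at hj
  exact hj

/-- The Poisson bracket with `{g, h} μ = k dg ∧ dh ∧ f^*Ω`. -/
noncomputable def jacobianPoisson : PoissonBracket (m + 2) M where
  bracket := LinearMap.mk₂ ℝ (jacobianBracket μ Ω f k)
    (fun g h l => by ext x; simp [jacobianBracket_apply, ContMDiffMap.mvfderiv_coe_add])
    (fun c g h => by ext x; simp [jacobianBracket_apply, ContMDiffMap.mvfderiv_coe_smul])
    (fun g h l => by ext x; simp [jacobianBracket_apply, ContMDiffMap.mvfderiv_coe_add])
    (fun c g h => by ext x; simp [jacobianBracket_apply, ContMDiffMap.mvfderiv_coe_smul])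
  bracket_self g := by ext x; exact bivector_self μ Ω f k x _
  jacobi := jacobianBracket_jacobi μ Ω f k
  leibniz_left g h l := by ext x; simp [jacobianBracket_apply, ContMDiffMap.mvfderiv_coe_mul]
  leibniz_right g h l := by ext x; simp [jacobianBracket_apply, ContMDiffMap.mvfderiv_coe_mul]

variable {f}

/-- `Sharp` quantifies over global functions; as every covector is the differential of one, it
becomes pointwise linear algebra. -/
lemma jacobianPoisson_sharp_iff [T2Space M] {x : M} {α : TangentSpace (𝓡 (m + 2)) x →L[ℝ] ℝ}
    {v : TangentSpace (𝓡 (m + 2)) x} : (jacobianPoisson μ Ω f k).Sharp x α v ↔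
      ∀ β : TangentSpace (𝓡 (m + 2)) x →L[ℝ] ℝ, β v = bivector μ Ω f k x β α := by
  constructor
  · rintro ⟨h, rfl, hv⟩ β
    obtain ⟨g, rfl⟩ := exists_mvfderiv_eq β
    exact hv g
  · intro hv
    obtain ⟨h, rfl⟩ := exists_mvfderiv_eq α
    exact ⟨h, rfl, fun g => hv _⟩

lemma exists_jacobianPoisson_sharp [T2Space M] (x : M) (α : TangentSpace (𝓡 (m + 2)) x →L[ℝ] ℝ) :
    ∃ v, (jacobianPoisson μ Ω f k).Sharp x α v := by
  obtain ⟨v, hv⟩ := exists_covector_apply_eq ((bivector μ Ω f k x).flip α)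
  exact ⟨v, (jacobianPoisson_sharp_iff μ Ω k).2 hv⟩

lemma mem_charDist_iff [T2Space M] {x : M} {v : TangentSpace (𝓡 (m + 2)) x} :
    v ∈ (jacobianPoisson μ Ω f k).charDist x ↔
      ∃ α : TangentSpace (𝓡 (m + 2)) x →L[ℝ] ℝ, (jacobianPoisson μ Ω f k).Sharp x α v := by
  constructor
  · rintro ⟨h, hv⟩
    exact ⟨_, hv⟩
  · rintro ⟨α, hv⟩
    obtain ⟨h, rfl⟩ := exists_mvfderiv_eq α
    exact ⟨h, hv⟩

lemma sharp_eq_zero_of_mem_criticalSet [T2Space M] {x : M} (hx : x ∈ criticalSet f)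
    {α : TangentSpace (𝓡 (m + 2)) x →L[ℝ] ℝ} {v : TangentSpace (𝓡 (m + 2)) x}
    (hv : (jacobianPoisson μ Ω f k).Sharp x α v) : v = 0 := by
  rw [jacobianPoisson_sharp_iff] at hv
  refine eq_of_covector_apply_eq fun β => ?_
  rw [hv, bivector_eq_zero_of_mem_criticalSet μ Ω f k hx, map_zero]

/-- Hamiltonian vectors are tangent to the fibres of `f`. -/
lemma mfderiv_sharp_eq_zero [T2Space M] {x : M} {α : TangentSpace (𝓡 (m + 2)) x →L[ℝ] ℝ}
    {v : TangentSpace (𝓡 (m + 2)) x} (hv : (jacobianPoisson μ Ω f k).Sharp x α v) :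
    mfderiv (𝓡 (m + 2)) (𝓡 m) f x v = 0 := by
  rw [jacobianPoisson_sharp_iff] at hv
  refine eq_of_covector_apply_eq fun β => ?_
  have h := hv (β ∘L mfderiv (𝓡 (m + 2)) (𝓡 m) f x)
  rw [bivector_comp_mfderiv_left] at h
  rw [map_zero]
  exact h

end Poisson

/-! ### Characteristic distribution and explicit trajectories in adapted charts -/

section Leaves

/-- The covector whose Hamiltonian direction in the plane is `w`. -/
noncomputable def planeConj {m : ℕ} (w : EuclideanSpace ℝ (Fin (m + 2))) :
    EuclideanSpace ℝ (Fin (m + 2)) →L[ℝ] ℝ :=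
  planeFst m w • planeSnd m - planeSnd m w • planeFst m

lemma planeConj_self {m : ℕ} (w : EuclideanSpace ℝ (Fin (m + 2))) : planeConj w w = 0 := by
  simp only [planeConj, sub_apply, smul_apply, smul_eq_mul]
  ring

variable {m : ℕ} {M : Type*} [TopologicalSpace M] [T2Space M]
  [ChartedSpace (EuclideanSpace ℝ (Fin (m + 2))) M]
  {N : Type*} [TopologicalSpace N] [ChartedSpace (EuclideanSpace ℝ (Fin m)) N]
  [IsManifold (𝓡 (m + 2)) ∞ M] [IsManifold (𝓡 m) ∞ N]
  (μ : VolumeForm (m + 2) M) (Ω : VolumeForm m N)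
  {f : C^∞⟮𝓡 (m + 2), M; 𝓡 m, N⟯} {k : C^∞⟮𝓡 (m + 2), M; ℝ⟯}
  {φ : OpenPartialHomeomorph M (EuclideanSpace ℝ (Fin (m + 2)))}
  {ψ : OpenPartialHomeomorph N (EuclideanSpace ℝ (Fin m))}

namespace IsAdaptedChart

/-- For `π = c ∂₁ ∧ ∂₂`, the vector `w₁ ∂₁ + w₂ ∂₂` is the image of `c⁻¹ (w₁ dy₂ - w₂ dy₁)`.
Consequently the characteristic distribution is all of `ker df` at regular points. -/
lemma sharp_planeConj (hc : IsAdaptedChart f φ ψ) {x : M} (hx : x ∈ φ.source) (hk : k x ≠ 0)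
    {v : TangentSpace (𝓡 (m + 2)) x} (hv : baseProj m (mvfderiv (𝓡 (m + 2)) φ x v) = 0) :
    (jacobianPoisson μ Ω f k).Sharp x (((planeCoeff f φ μ Ω k x)⁻¹ •
      planeConj (mvfderiv (𝓡 (m + 2)) φ x v)) ∘L mvfderiv (𝓡 (m + 2)) φ x) v := by
  rw [jacobianPoisson_sharp_iff]
  intro β
  obtain ⟨α, rfl⟩ := exists_covector_comp_chart hc.mem_atlas hx β
  rw [hc.bivector_comp μ Ω k hx, ContinuousLinearMap.comp_apply]
  set w := mvfderiv (𝓡 (m + 2)) φ x v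
  have h0 := hc.planeCoeff_ne_zero μ Ω k hx hk
  have hw := splitting_decomp w
  rw [hv] at hw
  have hα : α w = planeFst m w * α (vecFst m) + planeSnd m w * α (vecSnd m) := by
    conv_lhs => rw [hw]
    rw [map_add, map_add, map_smul, map_smul, smul_eq_mul, smul_eq_mul]
    have : ((0 : ℝ × ℝ), (0 : EuclideanSpace ℝ (Fin m))) = 0 := rfl
    rw [this, map_zero, map_zero, add_zero]
  rw [hα]
  simp only [planeConj, sub_apply, smul_apply, smul_eq_mul,
    planeFst_vecFst, planeFst_vecSnd, planeSnd_vecFst, planeSnd_vecSnd]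
  field_simp
  ring

lemma mem_charDist_iff (hc : IsAdaptedChart f φ ψ) {x : M} (hx : x ∈ φ.source) (hk : k x ≠ 0)
    (v : TangentSpace (𝓡 (m + 2)) x) : v ∈ (jacobianPoisson μ Ω f k).charDist x ↔
      baseProj m (mvfderiv (𝓡 (m + 2)) φ x v) = 0 := by
  rw [_root_.mem_charDist_iff]
  constructor
  · rintro ⟨α, hα⟩
    rw [← hc.mfderiv_eq_zero_iff hx]
    exact mfderiv_sharp_eq_zero μ Ω k hα
  · exact fun hv => ⟨_, hc.sharp_planeConj μ Ω hx hk hv⟩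

/-- Two points of a slice of an adapted chart are joined by a trajectory which is a straight line in
the chart. -/
lemma hamiltonianStep (hc : IsAdaptedChart f φ ψ) (hk : ∀ x, k x ≠ 0) {p q : M}
    (hp : p ∈ φ.source) (hq : q ∈ φ.source) (hpq : f p = f q) :
    (jacobianPoisson μ Ω f k).HamiltonianStep p q := by
  set w := φ q - φ p with hw_def
  have hw : baseProj m w = 0 := by
    rw [hw_def, map_sub, ← hc.apply_eq q hq, ← hc.apply_eq p hp, hpq, sub_self]
  -- Without the factor `c⁻¹` the Hamiltonian field would be `c w`. The linear factor is normalised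
  -- to vanish at `φ p`, hence on the whole line through `φ p` in direction `w`, so the derivative
  -- of `c⁻¹` contributes nothing there.
  let h : M → ℝ := fun x => planeConj w (φ x - φ p) * (planeCoeff f φ μ Ω k x)⁻¹
  have hh : ∀ x ∈ φ.source, ContMDiffAt (𝓡 (m + 2)) 𝓘(ℝ, ℝ) ∞ h x := fun x hx => by
    have h1 : ContDiff ℝ ∞ fun z : EuclideanSpace ℝ (Fin (m + 2)) => planeConj w (z - φ p) :=
      (planeConj w).contDiff.comp (contDiff_id.sub contDiff_const)
    exact (h1.contMDiff.contMDiffAt.comp x (contMDiffAt_of_mem_maximalAtlas hc.mem_atlas hx)).mul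
      ((hc.contMDiffAt_planeCoeff μ Ω k hx).inv₀ (hc.planeCoeff_ne_zero μ Ω k hx (hk x)))
  choose X hX using fun x => exists_jacobianPoisson_sharp μ Ω k (f := f) x
    (mvfderiv (𝓡 (m + 2)) h x)
  let line : ℝ → EuclideanSpace ℝ (Fin (m + 2)) := fun t => φ p + t • w
  have hline : ∀ t ∈ Set.Icc (0 : ℝ) 1, line t ∈ φ.target := fun t ht => by
    have := hc.convex.add_smul_sub_mem (φ.map_source hp) (φ.map_source hq) ht
    exact this
  have hdh : ∀ t ∈ Set.Icc (0 : ℝ) 1, ∀ v : TangentSpace (𝓡 (m + 2)) (φ.symm (line t)),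
      mvfderiv (𝓡 (m + 2)) h (φ.symm (line t)) v =
        (planeCoeff f φ μ Ω k (φ.symm (line t)))⁻¹ *
          planeConj w (mvfderiv (𝓡 (m + 2)) φ (φ.symm (line t)) v) := fun t ht v => by
    have hz := hline t ht
    have hx := φ.map_target hz
    rw [mvfderiv_eq_fderiv_comp_mfderiv hc.mem_atlas hx ((hh _ hx).mdifferentiableAt (by simp)),
      φ.right_inv hz]
    have h1 : HasFDerivAt (fun z => planeConj w (z - φ p)) (planeConj w) (line t) :=
      (planeConj w).hasFDerivAt.comp (line t) ((hasFDerivAt_id (line t)).sub_const (φ p))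
    have h2 : DifferentiableAt ℝ (fun z => ((planeCoeff f φ μ Ω k ∘ φ.symm) z)⁻¹) (line t) :=
      ((contDiffAt_comp_chart_symm hc.mem_atlas hz
        (hc.contMDiffAt_planeCoeff μ Ω k hx)).differentiableAt (by simp)).inv
        (hc.planeCoeff_ne_zero μ Ω k hx (hk _))
    have h3 : h ∘ φ.symm =ᶠ[nhds (line t)] fun z =>
        planeConj w (z - φ p) * ((planeCoeff f φ μ Ω k ∘ φ.symm) z)⁻¹ := by
      filter_upwards [φ.open_target.mem_nhds hz] with z hz
      simp [h, φ.right_inv hz]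
    have h4 : planeConj w (line t - φ p) = 0 := by
      simp [line, planeConj_self]
    rw [((h1.mul h2.hasFDerivAt).congr_of_eventuallyEq h3).fderiv, h4, zero_smul, zero_add]
    rfl
  -- Only on the segment is the field claimed to be `w` in the chart; off it the derivative of `c⁻¹`
  -- may contribute.
  have hXline : ∀ t ∈ Set.Icc (0 : ℝ) 1, X (φ.symm (line t)) =
      mfderiv (𝓡 (m + 2)) (𝓡 (m + 2)) φ.symm (line t) w := fun t ht => by
    have hz := hline t ht
    have hx := φ.map_target hz
    set u := mfderiv (𝓡 (m + 2)) (𝓡 (m + 2)) φ.symm (line t) w with hu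
    have hdu : mvfderiv (𝓡 (m + 2)) φ (φ.symm (line t)) u = w :=
      DFunLike.congr_fun
        ((mdifferentiable_of_mem_maximalAtlas hc.mem_atlas).comp_symm_deriv hz) w
    have hsu := hc.sharp_planeConj μ Ω hx (hk _) (v := u) (by rw [hdu, hw])
    rw [hdu] at hsu
    have hcov : mvfderiv (𝓡 (m + 2)) h (φ.symm (line t)) =
        ((planeCoeff f φ μ Ω k (φ.symm (line t)))⁻¹ • planeConj w) ∘L
          mvfderiv (𝓡 (m + 2)) φ (φ.symm (line t)) := by
      ext v
      rw [hdh t ht v]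
      rfl
    have hsX := hX (φ.symm (line t))
    rw [← hcov] at hsu
    rw [jacobianPoisson_sharp_iff] at hsX hsu
    exact eq_of_covector_apply_eq fun β => (hsX β).trans (hsu β).symm
  refine ⟨φ.source, h, X, φ.symm ∘ line, 0, 1, φ.open_source,
    fun x hx => (hh x hx).contMDiffWithinAt, fun x _ => hX x, zero_le_one, ?_, ?_,
    fun t ht => φ.map_target (hline t ht), fun t ht => ?_⟩
  · simp [line, φ.left_inv hp]
  · simp [line, hw_def, φ.left_inv hq]
  · have hz := hline t ht
    have h1 : HasFDerivAt line ((1 : ℝ →L[ℝ] ℝ).smulRight w) t :=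
      ((hasFDerivAt_id t).smul_const w).const_add (φ p)
    have h2 := ((mdifferentiable_of_mem_maximalAtlas hc.mem_atlas).mdifferentiableAt_symm
      hz).hasMFDerivAt.comp t h1.hasMFDerivAt
    refine (h2.congr_mfderiv ?_).hasMFDerivWithinAt
    refine ContinuousLinearMap.ext fun (s : ℝ) => ?_
    have h3 : X ((φ.symm ∘ line) t) = mfderiv (𝓡 (m + 2)) (𝓡 (m + 2)) φ.symm (line t) w :=
      hXline t ht
    have h4 := (mfderiv (𝓡 (m + 2)) (𝓡 (m + 2)) φ.symm (line t)).map_smul s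
      (w : TangentSpace (𝓡 (m + 2)) (line t))
    exact h4.trans (congrArg (s • ·) h3.symm)

end IsAdaptedChart

end Leaves

/-- Lets both kinds of 2-dimensional leaves be treated as components of a fibre minus `C`. -/
lemma preimage_diff_criticalSet {m : ℕ} {M : Type*} [TopologicalSpace M]
    [ChartedSpace (EuclideanSpace ℝ (Fin (m + 2))) M] {N : Type*} [TopologicalSpace N]
    [ChartedSpace (EuclideanSpace ℝ (Fin m)) N] {f : C^∞⟮𝓡 (m + 2), M; 𝓡 m, N⟯} {s : N} (hs : ¬ IsSingularValue f s) :
    f ⁻¹' {s} \ criticalSet f = f ⁻¹' {s} :=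
  sdiff_eq_left.2 (Set.disjoint_left.2 fun x hx hxC => hs ⟨x, hxC, hx⟩)

/-! ### Trajectories: constancy of `f`, and uniqueness at critical points -/

section HamiltonianCurves

variable {m : ℕ} {M : Type*} [TopologicalSpace M] [T2Space M]
  [ChartedSpace (EuclideanSpace ℝ (Fin (m + 2))) M]
  {N : Type*} [TopologicalSpace N] [ChartedSpace (EuclideanSpace ℝ (Fin m)) N]
  [IsManifold (𝓡 (m + 2)) ∞ M] [IsManifold (𝓡 m) ∞ N]
  {μ : VolumeForm (m + 2) M} {Ω : VolumeForm m N}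
  {f : C^∞⟮𝓡 (m + 2), M; 𝓡 m, N⟯} {k : C^∞⟮𝓡 (m + 2), M; ℝ⟯}
  {U : Set M} {h : M → ℝ} {X : ∀ x : M, TangentSpace (𝓡 (m + 2)) x} {γ : ℝ → M} {a b : ℝ}

/-- A Hamiltonian vector field is Lipschitz near a critical point, in a chart. -/
lemma exists_lipschitz_hamiltonian {q : M} (hU : IsOpen U) (hqU : q ∈ U)
    (hh : ContMDiffOn (𝓡 (m + 2)) 𝓘(ℝ, ℝ) ∞ h U)
    (hX : ∀ x ∈ U, (jacobianPoisson μ Ω f k).Sharp x (mvfderiv (𝓡 (m + 2)) h x) (X x))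
    {φ : OpenPartialHomeomorph M (EuclideanSpace ℝ (Fin (m + 2)))}
    (hφ : φ ∈ IsManifold.maximalAtlas (𝓡 (m + 2)) ∞ M) (hq : q ∈ φ.source) :
    ∃ (Y : EuclideanSpace ℝ (Fin (m + 2)) → EuclideanSpace ℝ (Fin (m + 2))) (K : NNReal),
      ∃ s ∈ nhds (φ q), LipschitzOnWith K Y s ∧
        ∀ x ∈ U ∩ φ.source, mvfderiv (𝓡 (m + 2)) φ x (X x) = Y (φ x) := by
  let pr : Fin (m + 2) → EuclideanSpace ℝ (Fin (m + 2)) →L[ℝ] ℝ := fun i => EuclideanSpace.proj i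
  -- The components of the field are the brackets of the chart coordinates with `h`, so smoothness
  -- of the bracket makes `Y` smooth at `φ q`, hence Lipschitz nearby.
  let Y : EuclideanSpace ℝ (Fin (m + 2)) → EuclideanSpace ℝ (Fin (m + 2)) := fun z =>
    WithLp.toLp 2 fun i => ((fun x => bivector μ Ω f k x (mvfderiv (𝓡 (m + 2)) (pr i ∘ φ) x)
      (mvfderiv (𝓡 (m + 2)) h x)) ∘ φ.symm) z
  have hY : ContDiffAt ℝ ∞ Y (φ q) := by
    rw [contDiffAt_euclidean]
    intro i
    refine contDiffAt_comp_chart_symm (F := ℝ) (g := fun x => bivector μ Ω f k x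
      (mvfderiv (𝓡 (m + 2)) (pr i ∘ φ) x) (mvfderiv (𝓡 (m + 2)) h x)) hφ (φ.map_source hq) ?_
    rw [φ.left_inv hq]
    exact contMDiffAt_bivector μ Ω f k
      ((pr i).contDiff.contMDiff.contMDiffAt.comp q (contMDiffAt_of_mem_maximalAtlas hφ hq))
      (hh.contMDiffAt (hU.mem_nhds hqU))
  obtain ⟨K, s, hs, hL⟩ := (hY.of_le (by simp : (1 : WithTop ℕ∞) ≤ ∞)).exists_lipschitzOnWith
  refine ⟨Y, K, s, hs, hL, fun x hx => ?_⟩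
  ext i
  have h1 := (jacobianPoisson_sharp_iff μ Ω k).1 (hX x hx.1)
    (mvfderiv (𝓡 (m + 2)) (pr i ∘ φ) x)
  have h2 : mvfderiv (𝓡 (m + 2)) (pr i ∘ φ) x (X x) = pr i (mvfderiv (𝓡 (m + 2)) φ x (X x)) := by
    rw [mvfderiv_clm_comp_chart hφ hx.2]
    rfl
  rw [h2] at h1
  have h3 : Y (φ x) i = bivector μ Ω f k x (mvfderiv (𝓡 (m + 2)) (pr i ∘ φ) x)
      (mvfderiv (𝓡 (m + 2)) h x) :=
    congrArg (fun z => bivector μ Ω f k z (mvfderiv (𝓡 (m + 2)) (pr i ∘ φ) z)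
      (mvfderiv (𝓡 (m + 2)) h z)) (φ.left_inv hx.2)
  exact h1.trans h3.symm

lemma IsMIntegralCurveOn.hasDerivWithinAt_comp {n n' : ℕ} {M : Type*} [TopologicalSpace M]
    [ChartedSpace (EuclideanSpace ℝ (Fin n)) M] {X : ∀ x : M, TangentSpace (𝓡 n) x}
    {γ : ℝ → M} {s : Set ℝ} (hγ : IsMIntegralCurveOn γ X s) {t : ℝ} (ht : t ∈ s)
    {g : M → EuclideanSpace ℝ (Fin n')} (hg : MDifferentiableAt (𝓡 n) (𝓡 n') g (γ t)) :
    HasDerivWithinAt (g ∘ γ) (mvfderiv (𝓡 n) g (γ t) (X (γ t))) s t := by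
  have h1 := hg.hasMFDerivAt.comp_hasMFDerivWithinAt t (hγ t ht)
  have h2 : ∀ A : ℝ →L[ℝ] EuclideanSpace ℝ (Fin n'), HasFDerivWithinAt (g ∘ γ) A s t →
      HasDerivWithinAt (g ∘ γ) (A 1) s t := fun A hA => hA.hasDerivWithinAt
  have h3 : ((mfderiv (𝓡 n) (𝓡 n') g (γ t)).comp
      ((1 : ℝ →L[ℝ] ℝ).smulRight (X (γ t)))) (1 : ℝ) =
      mfderiv (𝓡 n) (𝓡 n') g (γ t) ((1 : ℝ) • X (γ t)) := rfl
  rw [one_smul] at h3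
  exact (h2 _ (hasMFDerivWithinAt_iff_hasFDerivWithinAt.1 h1)).congr_deriv h3

/-- The field vanishes at `q`, so the constant curve solves the same Lipschitz equation in a chart,
and uniqueness applies on both sides of `t₀`. -/
lemma IsMIntegralCurveOn.eventually_eq_of_mem_criticalSet {q : M} (hq : q ∈ criticalSet f)
    (hU : IsOpen U) (hh : ContMDiffOn (𝓡 (m + 2)) 𝓘(ℝ, ℝ) ∞ h U)
    (hX : ∀ x ∈ U, (jacobianPoisson μ Ω f k).Sharp x (mvfderiv (𝓡 (m + 2)) h x) (X x))
    (hγU : ∀ t ∈ Set.Icc a b, γ t ∈ U) (hγ : IsMIntegralCurveOn γ X (Set.Icc a b)) {t₀ : ℝ}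
    (ht₀ : t₀ ∈ Set.Icc a b) (hγt₀ : γ t₀ = q) :
    ∀ᶠ t in nhdsWithin t₀ (Set.Icc a b), γ t = q := by
  set φ := chartAt (EuclideanSpace ℝ (Fin (m + 2))) q
  have hφ : φ ∈ IsManifold.maximalAtlas (𝓡 (m + 2)) ∞ M := IsManifold.chart_mem_maximalAtlas q
  have hqφ : q ∈ φ.source := mem_chart_source _ q
  have hqU : q ∈ U := hγt₀ ▸ hγU t₀ ht₀
  obtain ⟨Y, K, s, hs, hL, hXY⟩ := exists_lipschitz_hamiltonian hU hqU hh hX hφ hqφ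
  have hY0 : Y (φ q) = 0 := by
    rw [← hXY q ⟨hqU, hqφ⟩, sharp_eq_zero_of_mem_criticalSet μ Ω k hq (hX q hqU), map_zero]
  have hcont : ContinuousWithinAt γ (Set.Icc a b) t₀ := (hγ t₀ ht₀).continuousWithinAt
  have hev : ∀ᶠ t in nhdsWithin t₀ (Set.Icc a b), γ t ∈ φ.source ∧ φ (γ t) ∈ s := by
    have h1 : ∀ᶠ x in nhds (γ t₀), x ∈ φ.source ∧ φ x ∈ s := by
      rw [hγt₀]
      exact (φ.open_source.eventually_mem hqφ).and ((φ.continuousAt hqφ).eventually hs)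
    exact hcont.eventually h1
  obtain ⟨δ, hδ, hball⟩ := Metric.mem_nhdsWithin_iff.1 hev
  have hz : ∀ t ∈ Set.Icc a b, t ∈ Metric.ball t₀ δ →
      HasDerivWithinAt (φ ∘ γ) (Y ((φ ∘ γ) t)) (Set.Icc a b) t := fun t ht htb => by
    have h1 := (hball ⟨htb, ht⟩).1
    have h2 := hγ.hasDerivWithinAt_comp ht
      ((mdifferentiable_of_mem_maximalAtlas hφ).mdifferentiableAt h1)
    rwa [hXY _ ⟨hγU t ht, h1⟩] at h2
  have hconst : ∀ t S, HasDerivWithinAt (fun _ : ℝ => φ q) (Y (φ q)) S t := fun t S => by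
    rw [hY0]
    exact hasDerivWithinAt_const _ _ _
  refine Filter.mem_of_superset (inter_mem_nhdsWithin _ (Metric.ball_mem_nhds t₀ hδ)) ?_
  rintro t ⟨ht, htb⟩
  suffices hφt : (φ ∘ γ) t = φ q from φ.injOn (hball ⟨htb, ht⟩).1 hqφ hφt
  have hsub : ∀ r ∈ Set.uIcc t₀ t, r ∈ Set.Icc a b ∧ r ∈ Metric.ball t₀ δ := fun r hr =>
    ⟨Set.uIcc_subset_Icc ht₀ ht hr, (convex_ball t₀ δ).ordConnected.uIcc_subset
      (Metric.mem_ball_self hδ) htb hr⟩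
  -- Forward and backward uniqueness use one-sided derivatives, which the derivative within `Icc a
  -- b` supplies even at its endpoints.
  rcases le_total t₀ t with hle | hle
  · rw [Set.uIcc_of_le hle] at hsub
    refine ODE_solution_unique_of_mem_Icc_right (v := fun _ => Y) (s := fun _ => s) (K := K)
      (f := φ ∘ γ) (g := fun _ => φ q) (a := t₀) (b := t) (fun _ _ => hL) ?_ ?_ ?_
      continuousOn_const (fun r _ => hconst r _) (fun _ _ => mem_of_mem_nhds hs) ?_ ⟨hle, le_rfl⟩
    · exact fun r hr => ((hz r (hsub r hr).1 (hsub r hr).2).continuousWithinAt).mono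
        fun r' hr' => (hsub r' hr').1
    · intro r hr
      obtain ⟨h1, h2⟩ := hsub r (Set.Ico_subset_Icc_self hr)
      exact (hz r h1 h2).mono_of_mem_nhdsWithin
        (Icc_mem_nhdsGE_of_mem ⟨h1.1, hr.2.trans_le ht.2⟩)
    · exact fun r hr => (hball (hsub r (Set.Ico_subset_Icc_self hr)).symm).2
    · simp [hγt₀]
  · rw [Set.uIcc_of_ge hle] at hsub
    refine ODE_solution_unique_of_mem_Icc_left (v := fun _ => Y) (s := fun _ => s) (K := K)
      (f := φ ∘ γ) (g := fun _ => φ q) (a := t) (b := t₀) (fun _ _ => hL) ?_ ?_ ?_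
      continuousOn_const (fun r _ => hconst r _) (fun _ _ => mem_of_mem_nhds hs) ?_ ⟨le_rfl, hle⟩
    · exact fun r hr => ((hz r (hsub r hr).1 (hsub r hr).2).continuousWithinAt).mono
        fun r' hr' => (hsub r' hr').1
    · intro r hr
      obtain ⟨h1, h2⟩ := hsub r (Set.Ioc_subset_Icc_self hr)
      exact (hz r h1 h2).mono_of_mem_nhdsWithin
        (Icc_mem_nhdsLE_of_mem ⟨ht.1.trans_lt hr.1, h1.2⟩)
    · exact fun r hr => (hball (hsub r (Set.Ioc_subset_Icc_self hr)).symm).2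
    · simp [hγt₀]

/-- A trajectory of a Hamiltonian vector field through a critical point is constant. -/
lemma IsMIntegralCurveOn.eq_of_mem_criticalSet (hU : IsOpen U)
    (hh : ContMDiffOn (𝓡 (m + 2)) 𝓘(ℝ, ℝ) ∞ h U)
    (hX : ∀ x ∈ U, (jacobianPoisson μ Ω f k).Sharp x (mvfderiv (𝓡 (m + 2)) h x) (X x))
    (hγU : ∀ t ∈ Set.Icc a b, γ t ∈ U) (hγ : IsMIntegralCurveOn γ X (Set.Icc a b)) {t₀ t : ℝ}
    (ht₀ : t₀ ∈ Set.Icc a b) (hγt₀ : γ t₀ ∈ criticalSet f) (ht : t ∈ Set.Icc a b) :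
    γ t = γ t₀ := by
  -- The set of times at `γ t₀` is open by local uniqueness and closed because points are closed;
  -- the equivalence states both as one locally constant property.
  have key : (γ t₀ = γ t₀ ↔ γ t = γ t₀) := by
    refine isPreconnected_Icc.induction₂ (fun r r' => γ r = γ t₀ ↔ γ r' = γ t₀) (fun r hr => ?_)
      (fun _ _ _ _ _ _ h1 h2 => h1.trans h2) (fun _ _ _ _ h1 => h1.symm) ht₀ ht
    by_cases hrq : γ r = γ t₀
    · filter_upwards [hγ.eventually_eq_of_mem_criticalSet hγt₀ hU hh hX hγU hr hrq] with r' hr'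
      exact iff_of_true hrq hr'
    · filter_upwards [(hγ r hr).continuousWithinAt.eventually (isOpen_ne.mem_nhds hrq)] with r' hr'
      exact iff_of_false hrq hr'
  exact key.1 rfl

/-- `f` is constant along trajectories of Hamiltonian vector fields. -/
lemma IsMIntegralCurveOn.map_eq
    (hX : ∀ x ∈ U, (jacobianPoisson μ Ω f k).Sharp x (mvfderiv (𝓡 (m + 2)) h x) (X x))
    (hγU : ∀ t ∈ Set.Icc a b, γ t ∈ U) (hγ : IsMIntegralCurveOn γ X (Set.Icc a b)) {t₀ t : ℝ}
    (ht₀ : t₀ ∈ Set.Icc a b) (ht : t ∈ Set.Icc a b) : f (γ t₀) = f (γ t) := by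
  refine isPreconnected_Icc.induction₂ (fun r r' => f (γ r) = f (γ r')) (fun r hr => ?_)
    (fun _ _ _ _ _ _ h1 h2 => h1.trans h2) (fun _ _ _ _ h1 => h1.symm) ht₀ ht
  set ψ := chartAt (EuclideanSpace ℝ (Fin m)) (f (γ r))
  have hψ : ψ ∈ IsManifold.maximalAtlas (𝓡 m) ∞ N := IsManifold.chart_mem_maximalAtlas _
  have hev : ∀ᶠ t in nhdsWithin r (Set.Icc a b), f (γ t) ∈ ψ.source :=
    (f.contMDiff.continuous.continuousAt.comp_continuousWithinAt
      (hγ r hr).continuousWithinAt).eventually (ψ.open_source.mem_nhds (mem_chart_source _ _))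
  obtain ⟨δ, hδ, hball⟩ := Metric.mem_nhdsWithin_iff.1 hev
  -- In a chart of `N` the derivative of `f ∘ γ` is `df` of a Hamiltonian vector, hence zero. The
  -- mean value inequality on this convex set then gives constancy.
  have hd : ∀ t ∈ Metric.ball r δ ∩ Set.Icc a b,
      HasDerivWithinAt ((ψ ∘ f) ∘ γ) 0 (Metric.ball r δ ∩ Set.Icc a b) t := fun t ht => by
    have h1 : MDifferentiableAt (𝓡 m) (𝓡 m) ψ (f (γ t)) :=
      (mdifferentiable_of_mem_maximalAtlas hψ).mdifferentiableAt (hball ht)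
    have h2 : MDifferentiableAt (𝓡 (m + 2)) (𝓡 m) f (γ t) :=
      f.contMDiff.mdifferentiableAt (by simp)
    have h3 := hγ.hasDerivWithinAt_comp ht.2 (h1.comp (γ t) h2)
    have h4 : mvfderiv (𝓡 (m + 2)) (ψ ∘ f) (γ t) (X (γ t)) =
        mvfderiv (𝓡 m) ψ (f (γ t)) (mfderiv (𝓡 (m + 2)) (𝓡 m) f (γ t) (X (γ t))) :=
      DFunLike.congr_fun (mfderiv_comp (γ t) h1 h2) (X (γ t))
    rw [h4, mfderiv_sharp_eq_zero μ Ω k (hX _ (hγU t ht.2)), map_zero] at h3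
    exact h3.mono Set.inter_subset_right
  filter_upwards [inter_mem_nhdsWithin (Set.Icc a b) (Metric.ball_mem_nhds r hδ)] with t ht
  have h1 := ((convex_ball r δ).inter (convex_Icc a b)).norm_image_sub_le_of_norm_hasDerivWithin_le
    (C := 0) hd (by simp) ⟨Metric.mem_ball_self hδ, hr⟩ ⟨ht.2, ht.1⟩
  rw [zero_mul, norm_le_zero_iff, sub_eq_zero] at h1
  exact (ψ.injOn (hball ⟨ht.2, ht.1⟩) (mem_chart_source _ _) h1).symm

end HamiltonianCurves

/-! ### Identification of the leaves -/

section SymplecticLeaves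

variable {m : ℕ} {M : Type*} [TopologicalSpace M] [T2Space M]
  [ChartedSpace (EuclideanSpace ℝ (Fin (m + 2))) M]
  {N : Type*} [TopologicalSpace N] [ChartedSpace (EuclideanSpace ℝ (Fin m)) N]
  [IsManifold (𝓡 (m + 2)) ∞ M] [IsManifold (𝓡 m) ∞ N]
  (μ : VolumeForm (m + 2) M) (Ω : VolumeForm m N)
  {f : C^∞⟮𝓡 (m + 2), M; 𝓡 m, N⟯} {k : C^∞⟮𝓡 (m + 2), M; ℝ⟯}

lemma jacobianPoisson_leaf_of_mem {q : M} (hq : q ∈ criticalSet f) :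
    (jacobianPoisson μ Ω f k).leaf q = {q} := by
  refine Set.eq_singleton_iff_unique_mem.2 ⟨Relation.ReflTransGen.refl, fun p hp => ?_⟩
  have hp' : Relation.ReflTransGen (jacobianPoisson μ Ω f k).HamiltonianStep q p := hp
  induction hp' with
  | refl => rfl
  | @tail p p' h1 h2 ih =>
    obtain rfl := ih h1
    obtain ⟨U, h, X, γ, a, b, hU, hh, hX, hab, rfl, rfl, hγU, hγ⟩ := h2
    exact hγ.eq_of_mem_criticalSet hU hh hX hγU (Set.left_mem_Icc.2 hab) hq
      (Set.right_mem_Icc.2 hab)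

/-- A trajectory is connected and stays in a fibre. It avoids `C`, for otherwise it would be
constant and `p` critical. -/
lemma mem_connectedComponentIn_of_hamiltonianStep {p q : M} (hp : p ∉ criticalSet f)
    (hpq : (jacobianPoisson μ Ω f k).HamiltonianStep p q) :
    q ∈ connectedComponentIn (f ⁻¹' {f p} \ criticalSet f) p := by
  obtain ⟨U, h, X, γ, a, b, hU, hh, hX, hab, rfl, rfl, hγU, hγ⟩ := hpq
  have ha : a ∈ Set.Icc a b := Set.left_mem_Icc.2 hab
  have hpre : IsPreconnected (γ '' Set.Icc a b) :=
    isPreconnected_Icc.image γ fun t ht => (hγ t ht).continuousWithinAt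
  refine hpre.subset_connectedComponentIn ⟨a, ha, rfl⟩ ?_ ⟨b, Set.right_mem_Icc.2 hab, rfl⟩
  rintro _ ⟨t, ht, rfl⟩
  refine ⟨(hγ.map_eq hX hγU ha ht).symm, fun hcrit => hp ?_⟩
  rwa [hγ.eq_of_mem_criticalSet hU hh hX hγU ht hcrit ha]

lemma jacobianPoisson_leaf_of_notMem (hk : ∀ x, k x ≠ 0) {q : M} (hq : q ∉ criticalSet f) :
    (jacobianPoisson μ Ω f k).leaf q = connectedComponentIn (f ⁻¹' {f q} \ criticalSet f) q := by
  have hqS : q ∈ f ⁻¹' {f q} \ criticalSet f := ⟨rfl, hq⟩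
  refine Set.Subset.antisymm (fun p hp => ?_) (fun p hp => ?_)
  · have hp' : Relation.ReflTransGen (jacobianPoisson μ Ω f k).HamiltonianStep q p := hp
    induction hp' with
    | refl => exact mem_connectedComponentIn hqS
    | @tail p p' h1 h2 ih =>
      have hpc := ih h1
      have hpS := connectedComponentIn_subset _ _ hpc
      have h3 := mem_connectedComponentIn_of_hamiltonianStep μ Ω hpS.2 h2
      rw [show f p = f q from hpS.1] at h3
      rwa [connectedComponentIn_eq hpc]
  -- Being joined by steps is transitive and holds, in both directions, between `x` and every point
  -- of the component in an adapted chart around `x`; connectedness makes it global.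
  · refine isPreconnected_connectedComponentIn.induction₂'
      (fun x y => Relation.ReflTransGen (jacobianPoisson μ Ω f k).HamiltonianStep x y)
      (fun x hx => ?_) (fun _ _ _ _ _ _ h1 h2 => h1.trans h2) (mem_connectedComponentIn hqS) hp
    have hxS := connectedComponentIn_subset _ _ hx
    obtain ⟨φ, ψ, hc, hxφ⟩ := exists_isAdaptedChart hxS.2
    filter_upwards [self_mem_nhdsWithin,
      mem_nhdsWithin_of_mem_nhds (φ.open_source.mem_nhds hxφ)] with y hy hyφ
    have hxy : f x = f y := hxS.1.trans (connectedComponentIn_subset _ _ hy).1.symm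
    exact ⟨.single (hc.hamiltonianStep μ Ω hk hxφ hyφ hxy),
      .single (hc.hamiltonianStep μ Ω hk hyφ hxφ hxy.symm)⟩

/-- Every point of the chart in the fibre of `p` is one Hamiltonian step from `p`. The leaf thus
meets the chart in the entire slice through `p` and in no other. -/
lemma isIntegralSubmanifold_two (hk : ∀ x, k x ≠ 0) {q : M} (hq : q ∉ criticalSet f) :
    PoissonBracket.IsIntegralSubmanifold (jacobianPoisson μ Ω f k).charDist 2
      ((jacobianPoisson μ Ω f k).leaf q) := by
  intro p hp
  have hS : ∀ x ∈ (jacobianPoisson μ Ω f k).leaf q, x ∈ f ⁻¹' {f q} \ criticalSet f := fun x hx =>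
    connectedComponentIn_subset _ q (by rwa [← jacobianPoisson_leaf_of_notMem μ Ω hk hq])
  obtain ⟨φ, ψ, hc, hpφ⟩ := exists_isAdaptedChart (hS p hp).2
  refine ⟨φ, hc.mem_atlas, hpφ, LinearMap.ker (baseProj m).toLinearMap, finrank_ker_baseProj,
    fun x hx => ⟨?_, fun _ v => hc.mem_charDist_iff μ Ω hx (hk x) v⟩⟩
  have hW : φ x - φ p ∈ LinearMap.ker (baseProj m).toLinearMap ↔ f x = f p := by
    rw [LinearMap.mem_ker, ContinuousLinearMap.coe_coe, map_sub, ← hc.apply_eq x hx,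
      ← hc.apply_eq p hpφ, sub_eq_zero]
    exact ⟨fun h => ψ.injOn (hc.mem_source x hx) (hc.mem_source p hpφ) h, fun h => by rw [h]⟩
  rw [hW]
  exact ⟨fun h => (hS x h).1.trans (hS p hp).1.symm,
    fun h => Relation.ReflTransGen.tail hp (hc.hamiltonianStep μ Ω hk hpφ hx h.symm)⟩

lemma eq_zero_of_mem_charDist {q : M} (hq : q ∈ criticalSet f) {v : TangentSpace (𝓡 (m + 2)) q}
    (hv : v ∈ (jacobianPoisson μ Ω f k).charDist q) : v = 0 := by
  obtain ⟨α, hα⟩ := (mem_charDist_iff μ Ω k).1 hv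
  exact sharp_eq_zero_of_mem_criticalSet μ Ω k hq hα

lemma isIntegralSubmanifold_zero {q : M} (hq : q ∈ criticalSet f) :
    PoissonBracket.IsIntegralSubmanifold (jacobianPoisson μ Ω f k).charDist 0 {q} := by
  rintro p rfl
  set φ := chartAt (EuclideanSpace ℝ (Fin (m + 2))) p
  have hφ : φ ∈ IsManifold.maximalAtlas (𝓡 (m + 2)) ∞ M := IsManifold.chart_mem_maximalAtlas p
  have hpφ : p ∈ φ.source := mem_chart_source _ p
  refine ⟨φ, hφ, hpφ, ⊥, finrank_bot _ _, fun x hx => ⟨?_, ?_⟩⟩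
  · rw [Submodule.mem_bot, sub_eq_zero, Set.mem_singleton_iff]
    exact ⟨fun h => by rw [h], fun h => φ.injOn hx hpφ h⟩
  · rintro rfl v
    rw [Submodule.mem_bot]
    constructor
    · intro hv
      rw [eq_zero_of_mem_charDist μ Ω hq hv, map_zero]
    · intro hv
      have h0 : v = 0 := (mdifferentiable_of_mem_maximalAtlas hφ).mfderiv_injective hx
        ((show mfderiv (𝓡 (m + 2)) (𝓡 (m + 2)) φ x v = 0 from hv).trans (map_zero _).symm)
      rw [h0]
      exact Submodule.zero_mem _

/-- The tangent space of the leaf is the characteristic space, which is zero at a critical point. -/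
lemma notMem_criticalSet_of_isSymplecticLeaf_two {q : M}
    (h : (jacobianPoisson μ Ω f k).IsSymplecticLeaf 2 ((jacobianPoisson μ Ω f k).leaf q)) :
    q ∉ criticalSet f := by
  intro hq
  have hqL : q ∈ (jacobianPoisson μ Ω f k).leaf q := Relation.ReflTransGen.refl
  obtain ⟨φ, hφ, hqφ, W, hW, H⟩ := h.2 q hqL
  have hne : W ≠ ⊥ := by
    rintro rfl
    simp at hW
  obtain ⟨w, hw, hw0⟩ := W.exists_mem_ne_zero_of_ne_bot hne
  obtain ⟨v, hv⟩ := (mdifferentiable_of_mem_maximalAtlas hφ).mfderiv_surjective hqφ w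
  have hv' : mvfderiv (𝓡 (m + 2)) φ q v = w := hv
  have h1 := ((H q hqφ).2 hqL v).2 (by rwa [hv'])
  rw [eq_zero_of_mem_charDist μ Ω hq h1, map_zero] at hv'
  exact hw0 hv'.symm

/-- At a regular point the characteristic space contains the nonzero vector over `vecFst`. -/
lemma mem_criticalSet_of_isSymplecticLeaf_zero (hk : ∀ x, k x ≠ 0) {q : M}
    (h : (jacobianPoisson μ Ω f k).IsSymplecticLeaf 0 ((jacobianPoisson μ Ω f k).leaf q)) :
    q ∈ criticalSet f := by
  by_contra hq
  have hqL : q ∈ (jacobianPoisson μ Ω f k).leaf q := Relation.ReflTransGen.refl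
  obtain ⟨φ, hφ, hqφ, W, hW, H⟩ := h.2 q hqL
  obtain rfl := Submodule.finrank_eq_zero.1 hW
  obtain ⟨χ, ψ, hc, hqχ⟩ := exists_isAdaptedChart hq
  obtain ⟨v, hv⟩ := (mdifferentiable_of_mem_maximalAtlas hc.mem_atlas).mfderiv_surjective hqχ
    (vecFst m)
  have hv' : mvfderiv (𝓡 (m + 2)) χ q v = vecFst m := hv
  have h1 : v ∈ (jacobianPoisson μ Ω f k).charDist q := by
    rw [hc.mem_charDist_iff μ Ω hqχ (hk q), hv', baseProj_vecFst]
  have h2 := ((H q hqφ).2 hqL v).1 h1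
  rw [Submodule.mem_bot] at h2
  have h3 : v = 0 := (mdifferentiable_of_mem_maximalAtlas hφ).mfderiv_injective hqφ
    ((show mfderiv (𝓡 (m + 2)) (𝓡 (m + 2)) φ q v = 0 from h2).trans (map_zero _).symm)
  rw [h3, map_zero] at hv'
  have h4 := planeFst_vecFst (m := m)
  rw [← hv', map_zero] at h4
  exact zero_ne_one h4

lemma isSymplecticLeaf_zero {q : M} (hq : q ∈ criticalSet f) :
    (jacobianPoisson μ Ω f k).IsSymplecticLeaf 0 ((jacobianPoisson μ Ω f k).leaf q) :=
  ⟨⟨q, rfl⟩, by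
    rw [jacobianPoisson_leaf_of_mem μ Ω hq]
    exact isIntegralSubmanifold_zero μ Ω hq⟩

lemma isSymplecticLeaf_two (hk : ∀ x, k x ≠ 0) {q : M} (hq : q ∉ criticalSet f) :
    (jacobianPoisson μ Ω f k).IsSymplecticLeaf 2 ((jacobianPoisson μ Ω f k).leaf q) :=
  ⟨⟨q, rfl⟩, isIntegralSubmanifold_two μ Ω hk hq⟩

end SymplecticLeaves
theorem theorem2 {m : ℕ}
    {M : Type*} [TopologicalSpace M] [T2Space M] [SecondCountableTopology M]
    [ChartedSpace (EuclideanSpace ℝ (Fin (m + 2))) M] [IsManifold (𝓡 (m + 2)) ∞ M]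
    {N : Type*} [TopologicalSpace N] [T2Space N] [SecondCountableTopology N]
    [ChartedSpace (EuclideanSpace ℝ (Fin m)) N] [IsManifold (𝓡 m) ∞ N]
    (μ : VolumeForm (m + 2) M) (Ω : VolumeForm m N)
    (f : C^∞⟮𝓡 (m + 2), M; 𝓡 m, N⟯)
    (k : C^∞⟮𝓡 (m + 2), M; ℝ⟯) (hk : ∀ x, k x ≠ 0) :
    -- the formula defines a unique bracket
    (∃! br : C^∞⟮𝓡 (m + 2), M; ℝ⟯ → C^∞⟮𝓡 (m + 2), M; ℝ⟯ → C^∞⟮𝓡 (m + 2), M; ℝ⟯,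
      SatisfiesFormula μ Ω f k br) ∧
    -- it is a Poisson bracket
    ∃ P : PoissonBracket (m + 2) M, SatisfiesFormula μ Ω f k (fun g h => P.bracket g h) ∧
      -- every symplectic leaf is a submanifold of dimension 2 or 0
      (∀ q : M, P.IsSymplecticLeaf 2 (P.leaf q) ∨ P.IsSymplecticLeaf 0 (P.leaf q)) ∧
      -- the 2-dimensional leaves: the components of the regular fibres, and of the singular
      -- fibres with the critical set removed
      (∀ L : Set M, P.IsSymplecticLeaf 2 L ↔
        (∃ s : N, ¬ IsSingularValue f s ∧ IsComponentOf L (f ⁻¹' {s})) ∨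
        (∃ s : N, IsSingularValue f s ∧ IsComponentOf L (f ⁻¹' {s} \ criticalSet f))) ∧
      -- the 0-dimensional leaves: the points of the critical set
      (∀ L : Set M, P.IsSymplecticLeaf 0 L ↔ ∃ x ∈ criticalSet f, L = {x}) := by
  refine ⟨⟨jacobianBracket μ Ω f k, (satisfiesFormula_iff μ Ω f k _).2 rfl,
    fun br hbr => (satisfiesFormula_iff μ Ω f k br).1 hbr⟩, jacobianPoisson μ Ω f k,
    (satisfiesFormula_iff μ Ω f k _).2 rfl, fun q => ?_, fun L => ⟨?_, ?_⟩, fun L => ⟨?_, ?_⟩⟩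
  · by_cases hq : q ∈ criticalSet f
    · exact .inr (isSymplecticLeaf_zero μ Ω hq)
    · exact .inl (isSymplecticLeaf_two μ Ω hk hq)
  · intro hL
    obtain ⟨q, rfl⟩ := hL.1
    have hq := notMem_criticalSet_of_isSymplecticLeaf_two μ Ω hL
    rw [jacobianPoisson_leaf_of_notMem μ Ω hk hq]
    -- The point `q` is regular in both cases; only the rest of its fibre may contain critical
    -- points.
    by_cases hs : IsSingularValue f (f q)
    · exact .inr ⟨f q, hs, q, ⟨rfl, hq⟩, rfl⟩
    · exact .inl ⟨f q, hs, q, rfl, by rw [preimage_diff_criticalSet hs]⟩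
  · rintro (⟨s, hs, x, rfl, rfl⟩ | ⟨s, hs, x, ⟨rfl, hx⟩, rfl⟩)
    · have hx : x ∉ criticalSet f := fun hx => hs ⟨x, hx, rfl⟩
      rw [← preimage_diff_criticalSet hs, ← jacobianPoisson_leaf_of_notMem μ Ω hk hx]
      exact isSymplecticLeaf_two μ Ω hk hx
    · rw [← jacobianPoisson_leaf_of_notMem μ Ω hk hx]
      exact isSymplecticLeaf_two μ Ω hk hx
  · intro hL
    obtain ⟨q, rfl⟩ := hL.1
    have hq := mem_criticalSet_of_isSymplecticLeaf_zero μ Ω hk hL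
    exact ⟨q, hq, jacobianPoisson_leaf_of_mem μ Ω hq⟩
  · rintro ⟨x, hx, rfl⟩
    rw [← jacobianPoisson_leaf_of_mem μ Ω (k := k) hx]
    exact isSymplecticLeaf_zero μ Ω hx
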